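/- Let $J_n$ denote the Bessel functions of the first kind, let $\nu\ge 0$, and for integers $n\ge 0$ put $H_n^\nu(r)=n\,\frac{J_n(2r)}{r}\,e^{-\nu r}$ for $r>0$, extended to $r=0$ by continuity, so that $H_1^\nu(0)=1$ and $H_n^\nu(0)=0$ for $n\neq 1$ (in particular $H_0^\nu\equiv 0$). Let $L=(L(t))_{t\ge 0}$ be a one-dimensional Lévy process (a stochastically continuous process with stationary independent increments, $L(0)=0$, and right-continuous paths with left limits, almost surely). For a deterministic function $h$, the stochastic integral $\int_a^b h\,dY$ is the limit in probability of Riemann--Stieltjes sums over tagged partitions of $[a,b]$ as the mesh tends to $0$, and $\int_0^\infty h\,dL$ is the limit in probability of $\int_0^T h\,dL$ as $T\to\infty$. Then: 1. There is a unique function $\Psi:\mathbb R\to\mathbb C$ (the cumulant of $L$) with $\mathbf E e^{i\lambda L(t)}=e^{t\Psi(\lambda)}$ for all $t\ge 0$, $\lambda\in\mathbb R$. For each $t>0$, $\mathbf E L(t)^2<\infty$ if and only if $\Psi\in C^2(\mathbb R)$. 2. Suppose that $\Psi\in C^2(\mathbb R)$. Then the functions $H_n^\nu$ and $H_m^\nu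 H_n^\nu$ are Lebesgue integrable on $(0,\infty)$, and the integrals $a_n^\nu=\int_0^\infty H_n^\nu(r)\,dL(r)$, $n\ge 0$, exist. They are stationary pull-back limits in the following sense. (a) With the time-shifted process $L_s(t)=L(t-s)$, $t\ge s$, the integrals $\int_s^0 H_n^\nu(-r)\,dL_s(r)$, $s\le 0$, exist, and as $s\to-\infty$ they converge in distribution, jointly for any finite set of indices $n$, to the $a_n^\nu$. (b) If $L$ is the restriction to $[0,\infty)$ of a two-sided Lévy process $(M(t))_{t\in\mathbb R}$ and $L_s(t)=M(t)-M(s)$, then the integrals $\int_s^0 H_n^\nu(-r)\,dL_s(r)$, $s\le 0$, exist, and as $s\to-\infty$ they converge in probability for every $n$; the sequence of limits has the same joint law as $(a_n^\nu)_{n\ge 0}$. Moreover all $a_n^\nu$ are square integrable, and for all $m,n\ge 0$ $$\mathbf E a_n^\nu=-i\Psi'(0)\int_0^\infty H_n^\nu(r)\,dr,$$ $$\mathbf E\,a_m^\nu a_n^\nu=-\Psi''(0)\int_0^\infty H_m^\nu(r)H_n^\nu(r)\,dr-\Psi'(0)^2\int_0^\infty H_m^\nu(r)\,dr\int_0^\infty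 H_n^\nu(r)\,dr,$$ and hence $\operatorname{Cov}(a_m^\nu,a_n^\nu)=-\Psi''(0)\int_0^\infty H_m^\nu(r)H_n^\nu(r)\,dr$. 3. The covariance structure depends only on the first two moments of the forcing: if $L$ and $L'$ are Lévy processes with finite second moments, $\mathbf E L(1)=\mathbf E L'(1)$ and $\mathbf E L(1)^2=\mathbf E L'(1)^2$, then the families $a_n^\nu=\int_0^\infty H_n^\nu\,dL$ and $a_n'^\nu=\int_0^\infty H_n^\nu\,dL'$ have the same means, the same mixed second moments $\mathbf E a_m^\nu a_n^\nu$ and the same covariances, for all $m,n\ge 0$. In particular they agree with those of the Gaussian forcing (Brownian motion with drift) with the same first two moments. -/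

import Mathlib

open MeasureTheory ProbabilityTheory Filter Topology Set
open scoped NNReal

/-- The Bessel function of the first kind of integer order `n`, through Bessel's integral
`J_n(x) = (1/π) ∫_0^π cos (n θ - x sin θ) dθ`. -/
noncomputable def besselJ (n : ℕ) (x : ℝ) : ℝ :=
  Real.pi⁻¹ * ∫ θ in (0 : ℝ)..Real.pi, Real.cos (n * θ - x * Real.sin θ)

/-- The kernel `H_n^ν(r) = n J_n(2r) / r * exp (-ν r)`. At `r = 0` it is given its limit, which is
`1` for `n = 1` and `0` otherwise. (For `n = 0` the kernel vanishes identically, in agreement with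
the Dirichlet condition `a_0 = 0`.) -/
noncomputable def kernelH (ν : ℝ) (n : ℕ) (r : ℝ) : ℝ :=
  if r = 0 then (if n = 1 then 1 else 0)
  else n * besselJ n (2 * r) / r * Real.exp (-ν * r)

/-- `L` is a real Lévy process under `P`: it starts at the origin, has stationary independent
increments, is stochastically continuous, and almost all of its paths are right-continuous with
left limits. With `ι = ℝ≥0` these are the usual Lévy processes, with `ι = ℝ` the two-sided ones. -/
structure IsLevyProcess {ι Ω : Type*} [AddMonoid ι] [LinearOrder ι] [TopologicalSpace ι]
    [MeasurableSpace Ω] (L : ι → Ω → ℝ) (P : Measure Ω) : Prop where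
  measurable : ∀ t, Measurable (L t)
  start : ∀ᵐ ω ∂P, L 0 ω = 0
  indep_increments : HasIndepIncrements L P
  stationary_increments : ∀ s h : ι, 0 ≤ h →
    IdentDistrib (fun ω => L (s + h) ω - L s ω) (L h) P P
  stochastically_continuous : ∀ t, TendstoInMeasure P L (𝓝 t) (L t)
  cadlag : ∀ᵐ ω ∂P, ∀ t, ContinuousWithinAt (fun u => L u ω) (Ici t) t ∧
    ∃ l : ℝ, Tendsto (fun u => L u ω) (𝓝[<] t) (𝓝 l)

/-- `Ψ` is the cumulant of the process `L`: `E exp (i lam L(t)) = exp (t Ψ(lam))`. -/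
def IsCumulant {Ω : Type*} [MeasurableSpace Ω] (L : ℝ≥0 → Ω → ℝ) (P : Measure Ω)
    (Ψ : ℝ → ℂ) : Prop :=
  ∀ (t : ℝ≥0) (lam : ℝ), charFun (P.map (L t)) lam = Complex.exp ((t : ℝ) * Ψ lam)

/-- The random variable `X` is the stochastic integral `∫_a^b h(r) dY(r)` of the deterministic
function `h`: the Riemann--Stieltjes sums `∑ h(ξ_k) (Y(t_{k+1}) - Y(t_k))` over tagged partitions
of `[a, b]` converge to `X` in probability as the mesh of the partition tends to zero. -/
def IsStochIntegral {Ω : Type*} [MeasurableSpace Ω] (P : Measure Ω) (Y : ℝ → Ω → ℝ)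
    (h : ℝ → ℝ) (a b : ℝ) (X : Ω → ℝ) : Prop :=
  AEMeasurable X P ∧
  ∀ ε : ℝ, 0 < ε → ∃ δ : ℝ, 0 < δ ∧ ∀ (N : ℕ) (t ξ : ℕ → ℝ), Monotone t → t 0 = a → t N = b →
    (∀ k < N, t (k + 1) - t k < δ) → (∀ k < N, ξ k ∈ Icc (t k) (t (k + 1))) →
    P {ω | ε ≤ |∑ k ∈ Finset.range N, h (ξ k) * (Y (t (k + 1)) ω - Y (t k) ω) - X ω|}
      ≤ ENNReal.ofReal ε

/-- The time-shifted process `L_s(t) = L(t - s)`, `t ≥ s`, started at time `s`. -/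
noncomputable def shiftedProcess {Ω : Type*} (L : ℝ≥0 → Ω → ℝ) (s : ℝ) : ℝ → Ω → ℝ :=
  fun t => L (t - s).toNNReal

/-- The random variable `X` is the improper stochastic integral `∫_0^∞ h(r) dL(r)`, the limit in
probability of `∫_0^T h(r) dL(r)` as `T → ∞`. -/
def IsImproperStochIntegral {Ω : Type*} [MeasurableSpace Ω] (P : Measure Ω) (L : ℝ≥0 → Ω → ℝ)
    (h : ℝ → ℝ) (X : Ω → ℝ) : Prop :=
  AEMeasurable X P ∧ ∃ J : ℝ → Ω → ℝ,
    (∀ T, 0 ≤ T → IsStochIntegral P (shiftedProcess L 0) h 0 T (J T)) ∧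
    TendstoInMeasure P J atTop X

/-! Kernel. Integrating the derivative of `sin (n θ - x sin θ)` turns `n J_n(x)` into `x * besselCos
n x`, so `kernelH ν n r = 2 * besselCos n (2 r) * exp (-ν r)` is continuous and bounded by 2. An
energy estimate for the pair `(J_n, J_{n+1})` gives `x J_n(x)^2 = O(log x)`. This makes the kernel
`O(r^(-5/4))`, hence integrable even for `ν = 0`; products are bounded times integrable.

Cumulant. For fixed `lam`, `t ↦ E exp (i lam L(t))` is continuous and multiplicative, hence an
exponential `exp (t Ψ(lam))`. A `C^2` characteristic function forces a second moment (Fatou), and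
conversely `Ψ` is recovered from `exp (t Ψ)` by a local logarithm. Then `m = -iΨ'(0)` and `v =
-Ψ''(0)` are the mean and variance of `L(1)`.

Moments. The centred process has covariance `v min(s, t)`, which is `v` times the inner product of
the indicators of `(0, s]` and `(0, t]` in `L²(0, ∞)`. It therefore extends to `√v` times an
isometry, with values orthogonal to the constants (`exists_wienerMap`). Adding the drift `m ∫ g`
gives `levyIntegral`, and the moment formulas are inner products. A Riemann sum is the integral of a
step function, so uniform approximation of a continuous integrand gives convergence in `L²`, hence
in probability. Limits in probability are unique, so the formulas hold for every version of the
integral, and they see the forcing only through its first two moments.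

Pull-back. Characteristic functions of Riemann sums depend only on `Ψ`, and so do the joint laws of
the integrals. The integral against `L_s` is `∫_0^{-s} h(-s-r) dL(r)`; by time reversal it has the
law of `∫_0^{-s} h dL`, which converges. For a two-sided `M` it equals `∫_0^{-s} h dN` with the
fixed process `N(u) = -M(-u)`, so convergence holds in `L²`. `HasLevyIncrements` records what is
common to `L` and `N`. -/

/-! ### Bessel functions and integrability of the kernel -/

/-- The integral `(1/π) ∫_0^π cos θ cos (n θ - x sin θ) dθ = (J_{n-1}(x) + J_{n+1}(x)) / 2`. -/
noncomputable def besselCos (n : ℕ) (x : ℝ) : ℝ :=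
  Real.pi⁻¹ * ∫ θ in (0 : ℝ)..Real.pi, Real.cos θ * Real.cos (n * θ - x * Real.sin θ)

/-- The integral `(1/π) ∫_0^π sin θ sin (n θ - x sin θ) dθ = J_n'(x)`. -/
noncomputable def besselSin (n : ℕ) (x : ℝ) : ℝ :=
  Real.pi⁻¹ * ∫ θ in (0 : ℝ)..Real.pi, Real.sin θ * Real.sin (n * θ - x * Real.sin θ)

lemma besselJ_succ (n : ℕ) (x : ℝ) : besselJ (n + 1) x = besselCos n x - besselSin n x := by
  rw [besselJ, besselCos, besselSin, ← mul_sub, ← intervalIntegral.integral_sub]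
  · congr 2
    ext θ
    rw [show ((n + 1 : ℕ) : ℝ) * θ - x * Real.sin θ = θ + (n * θ - x * Real.sin θ) by
      push_cast; ring, Real.cos_add]
  all_goals exact Continuous.intervalIntegrable (by fun_prop) _ _

lemma besselJ_eq_add (n : ℕ) (x : ℝ) :
    besselJ n x = besselCos (n + 1) x + besselSin (n + 1) x := by
  rw [besselJ, besselCos, besselSin, ← mul_add, ← intervalIntegral.integral_add]
  · congr 2
    ext θ
    rw [show (n : ℝ) * θ - x * Real.sin θ = ((n + 1 : ℕ) * θ - x * Real.sin θ) - θ by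
      push_cast; ring, Real.cos_sub]
    ring
  all_goals exact Continuous.intervalIntegrable (by fun_prop) _ _

/-- The difference of the two sides is the integral of the derivative of `sin (n θ - x sin θ)`,
which vanishes at `θ = 0` and `θ = π`. -/
lemma natCast_mul_besselJ (n : ℕ) (x : ℝ) : n * besselJ n x = x * besselCos n x := by
  have h : ∫ θ in (0 : ℝ)..Real.pi,
      ((n : ℝ) - x * Real.cos θ) * Real.cos (n * θ - x * Real.sin θ) = 0 := by
    have hd : ∀ θ ∈ uIcc 0 Real.pi, HasDerivAt (fun θ : ℝ => Real.sin (n * θ - x * Real.sin θ))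
        (((n : ℝ) - x * Real.cos θ) * Real.cos (n * θ - x * Real.sin θ)) θ := by
      intro θ _
      have := (((hasDerivAt_id' θ).const_mul (n : ℝ)).fun_sub
        ((Real.hasDerivAt_sin θ).const_mul x)).sin
      refine this.congr_deriv ?_
      ring
    rw [intervalIntegral.integral_eq_sub_of_hasDerivAt hd
      (Continuous.intervalIntegrable (by fun_prop) _ _)]
    simp [Real.sin_nat_mul_pi]
  have h2 : ∫ θ in (0 : ℝ)..Real.pi,
      ((n : ℝ) - x * Real.cos θ) * Real.cos (n * θ - x * Real.sin θ)
      = n * (∫ θ in (0 : ℝ)..Real.pi, Real.cos (n * θ - x * Real.sin θ))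
        - x * ∫ θ in (0 : ℝ)..Real.pi, Real.cos θ * Real.cos (n * θ - x * Real.sin θ) := by
    rw [← intervalIntegral.integral_const_mul, ← intervalIntegral.integral_const_mul,
      ← intervalIntegral.integral_sub]
    · congr 1
      ext θ
      ring
    all_goals exact Continuous.intervalIntegrable (by fun_prop) _ _
  rw [besselJ, besselCos]
  linear_combination Real.pi⁻¹ * (h - h2)

lemma hasDerivAt_besselJ (n : ℕ) (x : ℝ) : HasDerivAt (besselJ n) (besselSin n x) x := by
  unfold besselSin
  refine HasDerivAt.const_mul _ ?_
  refine (intervalIntegral.hasDerivAt_integral_of_dominated_loc_of_deriv_le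
    (F := fun y θ => Real.cos (n * θ - y * Real.sin θ))
    (F' := fun y θ => Real.sin θ * Real.sin (n * θ - y * Real.sin θ)) (s := univ)
    (bound := fun _ => 1) univ_mem (Eventually.of_forall fun y => ?_) ?_ ?_ ?_ ?_ ?_).2
  · exact Continuous.aestronglyMeasurable (by fun_prop)
  · exact Continuous.intervalIntegrable (by fun_prop) _ _
  · exact Continuous.aestronglyMeasurable (by fun_prop)
  · refine Eventually.of_forall fun θ _ y _ => ?_
    rw [norm_mul]
    exact mul_le_one₀ (Real.abs_sin_le_one _) (norm_nonneg _) (Real.abs_sin_le_one _)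
  · exact intervalIntegrable_const
  · refine Eventually.of_forall fun θ _ y _ => ?_
    have := ((hasDerivAt_const y ((n : ℝ) * θ)).fun_sub
      ((hasDerivAt_id' y).mul_const (Real.sin θ))).cos
    refine this.congr_deriv ?_
    ring

lemma abs_inv_pi_mul_integral_le {f : ℝ → ℝ} (hf : ∀ θ, |f θ| ≤ 1) :
    |Real.pi⁻¹ * ∫ θ in (0 : ℝ)..Real.pi, f θ| ≤ 1 := by
  have h := intervalIntegral.norm_integral_le_of_norm_le_const (a := 0) (b := Real.pi) (f := f)
    (C := 1) (fun θ _ => hf θ)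
  rw [sub_zero, abs_of_pos Real.pi_pos, one_mul, Real.norm_eq_abs] at h
  rw [abs_mul, abs_of_pos (inv_pos.2 Real.pi_pos), inv_mul_le_iff₀ Real.pi_pos, mul_one]
  exact h

lemma abs_besselJ_le_one (n : ℕ) (x : ℝ) : |besselJ n x| ≤ 1 :=
  abs_inv_pi_mul_integral_le fun _ => Real.abs_cos_le_one _

lemma abs_besselCos_le_one (n : ℕ) (x : ℝ) : |besselCos n x| ≤ 1 :=
  abs_inv_pi_mul_integral_le fun _ => by
    rw [abs_mul]
    exact mul_le_one₀ (Real.abs_cos_le_one _) (abs_nonneg _) (Real.abs_cos_le_one _)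

lemma continuous_besselCos (n : ℕ) : Continuous (besselCos n) := by
  unfold besselCos
  refine continuous_const.mul ?_
  exact intervalIntegral.continuous_parametric_intervalIntegral_of_continuous' (by fun_prop) _ _

lemma besselJ_zero_right (n : ℕ) : besselJ n 0 = if n = 0 then 1 else 0 := by
  split_ifs with h
  · simp [besselJ, h, Real.pi_ne_zero]
  · have := natCast_mul_besselJ n 0
    rw [zero_mul] at this
    exact (mul_eq_zero.1 this).resolve_left (by exact_mod_cast h)

lemma besselCos_zero_right (n : ℕ) : besselCos n 0 = if n = 1 then 1 / 2 else 0 := by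
  cases n with
  | zero => simp [besselCos]
  | succ n =>
    -- Adding the two recurrences of index `n + 1` gives `besselCos (n + 1) 0 = (J_n(0) +
    -- J_{n+2}(0)) / 2`.
    have h1 := besselJ_eq_add n 0
    have h2 := besselJ_succ (n + 1) 0
    rw [besselJ_zero_right] at h1 h2
    by_cases hn : n = 0 <;> simp [hn] at h1 h2 ⊢ <;> linarith

/-- Removes the division by `r`, so that continuity at the origin and boundedness can be read off.
-/
lemma kernelH_eq (ν : ℝ) (n : ℕ) (r : ℝ) :
    kernelH ν n r = 2 * besselCos n (2 * r) * Real.exp (-ν * r) := by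
  unfold kernelH
  split_ifs with hr hn
  · simp [hr, besselCos_zero_right, hn]
  · simp [hr, besselCos_zero_right, hn]
  · rw [natCast_mul_besselJ]
    field_simp

lemma continuous_kernelH (ν : ℝ) (n : ℕ) : Continuous (kernelH ν n) := by
  have := continuous_besselCos n
  rw [funext (kernelH_eq ν n)]
  fun_prop

lemma besselSin_eq_sub (n : ℕ) {x : ℝ} (hx : x ≠ 0) :
    besselSin n x = n * besselJ n x / x - besselJ (n + 1) x := by
  rw [besselJ_succ, natCast_mul_besselJ]
  field_simp
  ring

lemma besselSin_succ_eq_sub (n : ℕ) {x : ℝ} (hx : x ≠ 0) :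
    besselSin (n + 1) x = besselJ n x - (n + 1) * besselJ (n + 1) x / x := by
  have := natCast_mul_besselJ (n + 1) x
  push_cast at this
  rw [this, besselJ_eq_add]
  field_simp
  ring

/-- With `A = J_n` and `B = J_{n+1}`, the recurrences give `(x (A² + B²))' = (2n+1)(A² - B²)` and
`(A B)' = A² - B² - A B / x`. Hence the corrected energy `E` satisfies `E' = (2n+1) A B / x ≤ (2n+1)
/ x`, and `E - (2n+1) log` decreases on `[1, ∞)`. The logarithmic loss is harmless below. -/
lemma mul_sq_besselJ_le (n : ℕ) {x : ℝ} (hx : 1 ≤ x) :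
    x * besselJ n x ^ 2 ≤ 2 + 2 * (2 * n + 1) + (2 * n + 1) * Real.log x := by
  set E : ℝ → ℝ := fun x => x * (besselJ n x ^ 2 + besselJ (n + 1) x ^ 2)
    - (2 * n + 1) * (besselJ n x * besselJ (n + 1) x) with hE
  have hAB : ∀ y, |besselJ n y * besselJ (n + 1) y| ≤ 1 := fun y => by
    rw [abs_mul]
    exact mul_le_one₀ (abs_besselJ_le_one _ _) (abs_nonneg _) (abs_besselJ_le_one _ _)
  have hd : ∀ y, 0 < y → HasDerivAt (fun y => E y - (2 * n + 1) * Real.log y)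
      ((2 * n + 1) * (besselJ n y * besselJ (n + 1) y - 1) / y) y := by
    intro y hy
    have hA := hasDerivAt_besselJ n y
    have hB := hasDerivAt_besselJ (n + 1) y
    rw [besselSin_eq_sub n hy.ne'] at hA
    rw [besselSin_succ_eq_sub n hy.ne'] at hB
    have := (((hasDerivAt_id' y).fun_mul ((hA.fun_pow 2).fun_add (hB.fun_pow 2))).fun_sub
      ((hA.fun_mul hB).const_mul (2 * (n : ℝ) + 1))).fun_sub
      ((Real.hasDerivAt_log hy.ne').const_mul (2 * (n : ℝ) + 1))
    refine this.congr_deriv ?_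
    norm_num
    field_simp
    ring
  have hanti : AntitoneOn (fun y => E y - (2 * n + 1) * Real.log y) (Ici 1) := by
    refine antitoneOn_of_deriv_nonpos (convex_Ici 1)
      (fun y hy => (hd y (lt_of_lt_of_le one_pos hy)).continuousAt.continuousWithinAt)
      (fun y hy => ?_) (fun y hy => ?_)
    all_goals
      rw [interior_Ici] at hy
      have hy0 : 0 < y := one_pos.trans hy
    · exact (hd y hy0).differentiableAt.differentiableWithinAt
    · rw [(hd y hy0).deriv]
      refine div_nonpos_of_nonpos_of_nonneg ?_ hy0.le
      refine mul_nonpos_of_nonneg_of_nonpos (by positivity) ?_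
      linarith [(abs_le.1 (hAB y)).2]
  have h1 := hanti (mem_Ici.2 le_rfl) (mem_Ici.2 hx) hx
  simp only [hE, Real.log_one, mul_zero, sub_zero, one_mul] at h1
  have hA1 : besselJ n 1 ^ 2 ≤ 1 := (sq_le_one_iff_abs_le_one _).2 (abs_besselJ_le_one _ _)
  have hB1 : besselJ (n + 1) 1 ^ 2 ≤ 1 := (sq_le_one_iff_abs_le_one _).2 (abs_besselJ_le_one _ _)
  have hn : (0 : ℝ) ≤ 2 * n + 1 := by positivity
  have e1 := mul_le_mul_of_nonneg_left (abs_le.1 (hAB 1)).1 hn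
  have e2 := mul_le_mul_of_nonneg_left (abs_le.1 (hAB x)).2 hn
  have e3 : 0 ≤ x * besselJ (n + 1) x ^ 2 := by positivity
  linarith

/-- Any power decay suffices. From `log x ≤ 2 √x` and `1 ≤ √x` the previous bound becomes `x J_n² ≤
(8n+6) √x`, and `8n+6 ≤ (8n+6)²`. -/
lemma abs_besselJ_le_rpow (n : ℕ) {x : ℝ} (hx : 1 ≤ x) :
    |besselJ n x| ≤ (8 * n + 6) * x ^ (-(1 / 4) : ℝ) := by
  have hx0 : 0 < x := one_pos.trans_le hx
  have hs : (x ^ (-(1 / 4) : ℝ)) ^ 2 = (√x)⁻¹ := by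
    rw [← Real.rpow_natCast, ← Real.rpow_mul hx0.le, Real.sqrt_eq_rpow, ← Real.rpow_neg hx0.le]
    norm_num
  have hs1 : 1 ≤ √x := Real.one_le_sqrt.2 hx
  have hlog : Real.log x ≤ 2 * √x := by
    have := Real.log_le_sub_one_of_pos (Real.sqrt_pos.2 hx0)
    rw [Real.log_sqrt hx0.le] at this
    linarith
  have h := mul_sq_besselJ_le n hx
  have hn : (0 : ℝ) ≤ n := n.cast_nonneg
  refine abs_le_of_sq_le_sq ?_ (by positivity)
  rw [mul_pow, hs, ← div_eq_mul_inv, le_div_iff₀ (by positivity)]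
  have h3 : √x * (√x * besselJ n x ^ 2) ≤ √x * (8 * n + 6) := by
    have : √x * (√x * besselJ n x ^ 2) = x * besselJ n x ^ 2 := by
      rw [← mul_assoc, Real.mul_self_sqrt hx0.le]
    rw [this]
    nlinarith
  have h4 := le_of_mul_le_mul_left h3 (by positivity)
  nlinarith

lemma abs_kernelH_le {ν : ℝ} (hν : 0 ≤ ν) (n : ℕ) {r : ℝ} (hr : 0 ≤ r) : |kernelH ν n r| ≤ 2 := by
  rw [kernelH_eq, abs_mul, abs_mul, abs_two, Real.abs_exp]
  have h1 : Real.exp (-ν * r) ≤ 1 := Real.exp_le_one_iff.2 (by nlinarith)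
  have h2 := abs_besselCos_le_one n (2 * r)
  calc _ ≤ (2 : ℝ) * 1 * 1 := by gcongr
    _ = 2 := by norm_num

lemma integrableOn_kernelH {ν : ℝ} (hν : 0 ≤ ν) (n : ℕ) : IntegrableOn (kernelH ν n) (Ioi 0) := by
  rw [← Ioc_union_Ioi_eq_Ioi zero_le_one, integrableOn_union]
  refine ⟨((continuous_kernelH ν n).continuousOn.integrableOn_Icc).mono_set Ioc_subset_Icc_self, ?_⟩
  -- The exponent `-5/4` is the decay `-1/4` of `J_n` together with the factor `1/r`; the
  -- exponential is only used as a factor at most 1.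
  have hI : IntegrableOn (fun r : ℝ => (n * (8 * n + 6) : ℝ) * r ^ (-(5 / 4) : ℝ)) (Ioi 1) :=
    (integrableOn_Ioi_rpow_of_lt (by norm_num) one_pos).const_mul _
  refine hI.mono' (continuous_kernelH ν n).aestronglyMeasurable ?_
  refine (ae_restrict_iff' measurableSet_Ioi).2 (Eventually.of_forall fun r hr => ?_)
  have hr1 : 1 < r := hr
  have hr0 : 0 < r := one_pos.trans hr1
  rw [kernelH, if_neg hr0.ne', Real.norm_eq_abs, abs_mul, abs_div, abs_mul, Nat.abs_cast,
    Real.abs_exp, abs_of_pos hr0]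
  have h1 : Real.exp (-ν * r) ≤ 1 := Real.exp_le_one_iff.2 (by nlinarith)
  have h2 := abs_besselJ_le_rpow n (x := 2 * r) (by linarith)
  have h3 : (2 * r) ^ (-(1 / 4) : ℝ) ≤ r ^ (-(1 / 4) : ℝ) :=
    Real.rpow_le_rpow_of_nonpos hr0 (by linarith) (by norm_num)
  have h4 : r ^ (-(5 / 4) : ℝ) = r ^ (-(1 / 4) : ℝ) / r := by
    rw [← Real.rpow_sub_one hr0.ne']; norm_num
  calc _ ≤ n * ((8 * n + 6) * r ^ (-(1 / 4) : ℝ)) / r * 1 := by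
        gcongr
        exact h2.trans (by gcongr)
    _ = _ := by rw [h4]; ring

lemma integrableOn_kernelH_mul_kernelH {ν : ℝ} (hν : 0 ≤ ν) (m n : ℕ) :
    IntegrableOn (fun r => kernelH ν m r * kernelH ν n r) (Ioi 0) := by
  refine (integrableOn_kernelH hν n).bdd_mul (c := 2)
    (continuous_kernelH ν m).aestronglyMeasurable ?_
  exact (ae_restrict_iff' measurableSet_Ioi).2
    (Eventually.of_forall fun r hr => abs_kernelH_le hν m (le_of_lt hr))

/-! ### Existence and regularity of the cumulant -/

/-- A continuous multiplicative function on `[0, ∞)` is an exponential. -/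
theorem exists_eq_exp_mul_of_continuous {φ : ℝ → ℂ} (hc : Continuous φ) (h0 : φ 0 = 1)
    (hmul : ∀ s t, 0 ≤ s → 0 ≤ t → φ (s + t) = φ s * φ t) :
    ∃ k : ℂ, ∀ t : ℝ, 0 ≤ t → φ t = Complex.exp (t * k) := by
  -- Multiplicativity gives `φ t * F h = F (t + h) - F t`; once `F h ≠ 0`, this makes `φ`
  -- differentiable.
  set F : ℝ → ℂ := fun t => ∫ u in (0 : ℝ)..t, φ u with hF
  have hFd : ∀ t, HasDerivAt F (φ t) t := fun t =>
    intervalIntegral.integral_hasDerivAt_right (hc.intervalIntegrable _ _)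
      (hc.stronglyMeasurableAtFilter _ _) hc.continuousAt
  obtain ⟨h, hFh, hh⟩ : ∃ h : ℝ, F h ≠ 0 ∧ 0 < h := by
    have h1 : ∀ᶠ t in 𝓝[≠] (0 : ℝ), F t ≠ 0 := (hFd 0).eventually_ne (by simp [h0])
    have h2 : ∀ᶠ t in 𝓝[>] (0 : ℝ), F t ≠ 0 := h1.filter_mono (nhdsGT_le_nhdsNE 0)
    obtain ⟨t, ht1, ht2⟩ := (h2.and self_mem_nhdsWithin).exists
    exact ⟨t, ht1, ht2⟩
  have hG : ∀ t, 0 ≤ t → φ t = (F (t + h) - F t) / F h := by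
    intro t ht
    rw [eq_div_iff hFh]
    have e1 : F (t + h) - F t = ∫ u in t..(t + h), φ u :=
      intervalIntegral.integral_interval_sub_left (hc.intervalIntegrable _ _)
        (hc.intervalIntegrable _ _)
    have e2 : (∫ u in t..(t + h), φ u) = ∫ u in (0 : ℝ)..h, φ (t + u) := by
      rw [intervalIntegral.integral_comp_add_left, add_zero]
    rw [e1, e2, hF, ← intervalIntegral.integral_const_mul]
    refine intervalIntegral.integral_congr fun u hu => ?_
    rw [uIcc_of_le hh.le] at hu
    exact (hmul t u ht hu.1).symm
  -- Differentiating the formula `hG` yields `φ' = k φ`, so `φ t * exp (-t k)` is constant.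
  set k : ℂ := (φ h - 1) / F h with hk
  refine ⟨k, fun T hT => ?_⟩
  set G : ℝ → ℂ := fun t => (F (t + h) - F t) / F h * Complex.exp (-(t * k)) with hGdef
  have hGd : ∀ t, 0 ≤ t → HasDerivAt G 0 t := by
    intro t ht
    have d1 : HasDerivAt (fun t => (F (t + h) - F t) / F h) ((φ (t + h) - φ t) / F h) t :=
      (((hFd (t + h)).comp_add_const t h).fun_sub (hFd t)).div_const _
    have d2 : HasDerivAt (fun t : ℝ => Complex.exp (-(t * k)))
        (Complex.exp (-(t * k)) * (-(1 * k))) t :=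
      (((hasDerivAt_id t).ofReal_comp.mul_const k).fun_neg).cexp
    refine (d1.fun_mul d2).congr_deriv ?_
    rw [hmul t h ht hh.le, ← hG t ht, hk]
    ring
  have hconst := constant_of_has_deriv_right_zero (f := G) (a := 0) (b := T)
    (fun t ht => (hGd t ht.1).continuousAt.continuousWithinAt)
    (fun t ht => (hGd t ht.1).hasDerivWithinAt) T ⟨hT, le_rfl⟩
  simp only [hGdef] at hconst
  rw [← hG T hT, ← hG 0 le_rfl, h0, Complex.exp_neg] at hconst
  simpa [mul_inv_eq_one₀ (Complex.exp_ne_zero _)] using hconst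

lemma hasDerivAt_cexp_ofReal_mul (z : ℂ) (t : ℝ) :
    HasDerivAt (fun t : ℝ => Complex.exp (t * z)) (Complex.exp (t * z) * z) t := by
  simpa using ((hasDerivAt_id t).ofReal_comp.mul_const z).cexp

/-- Comparing right derivatives at `t = 0` avoids the `2πi` ambiguity of the logarithm at a single
time. -/
lemma eq_of_forall_cexp_mul_eq {z w : ℂ}
    (h : ∀ t : ℝ, 0 ≤ t → Complex.exp (t * z) = Complex.exp (t * w)) : z = w := by
  have h1 := (hasDerivAt_cexp_ofReal_mul z 0).hasDerivWithinAt (s := Ici 0)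
  have h2 := (hasDerivAt_cexp_ofReal_mul w 0).hasDerivWithinAt (s := Ici 0)
  have h3 := (uniqueDiffOn_Ici (0 : ℝ) 0 self_mem_Ici).eq_deriv _
    (h1.congr_of_mem (fun t ht => (h t ht).symm) self_mem_Ici) h2
  simpa using h3

lemma tendsto_charFun_of_tendstoInMeasure {Ω ι : Type*} [MeasurableSpace Ω] {P : Measure Ω}
    [IsProbabilityMeasure P] {l : Filter ι} [l.IsCountablyGenerated] {X : ι → Ω → ℝ} {Z : Ω → ℝ}
    (h : TendstoInMeasure P X l Z) (hX : ∀ i, AEMeasurable (X i) P) (hZ : AEMeasurable Z P)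
    (lam : ℝ) :
    Tendsto (fun i => charFun (P.map (X i)) lam) l (𝓝 (charFun (P.map Z) lam)) := by
  have hd := (h.tendstoInDistribution_of_aemeasurable hX hZ).tendsto
  have := (ProbabilityMeasure.tendsto_iff_forall_integral_rclike_tendsto ℂ).1 hd
    (BoundedContinuousFunction.innerProbChar lam)
  simpa [charFun_eq_integral_innerProbChar] using this

section Cumulant

variable {Ω : Type*} [MeasurableSpace Ω] {P : Measure Ω} [IsProbabilityMeasure P]
  {L : ℝ≥0 → Ω → ℝ}

lemma IsLevyProcess.charFun_add (hL : IsLevyProcess L P) (s t : ℝ≥0) (lam : ℝ) :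
    charFun (P.map (L (s + t))) lam
      = charFun (P.map (L s)) lam * charFun (P.map (L t)) lam := by
  have hi : (L s) ⟂ᵢ[P] (L (s + t) - L s) :=
    hL.indep_increments.indepFun_eval_sub (r := 0) zero_le (le_add_of_nonneg_right zero_le)
      hL.start
  have h := hi.charFun_map_add_eq_mul (hL.measurable s).aemeasurable
    ((hL.measurable (s + t)).sub (hL.measurable s)).aemeasurable
  rw [add_sub_cancel] at h
  have h2 : P.map (L (s + t) - L s) = P.map (L t) :=
    (hL.stationary_increments s t zero_le).map_eq
  rw [h, h2]
  rfl

lemma IsLevyProcess.charFun_zero_time (hL : IsLevyProcess L P) (lam : ℝ) :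
    charFun (P.map (L 0)) lam = 1 := by
  rw [Measure.map_congr (g := fun _ => (0 : ℝ)) hL.start, Measure.map_const]
  simp

theorem IsLevyProcess.existsUnique_isCumulant (hL : IsLevyProcess L P) :
    ∃! Ψ : ℝ → ℂ, IsCumulant L P Ψ := by
  have hex : ∀ lam, ∃ k : ℂ, ∀ t : ℝ, 0 ≤ t →
      charFun (P.map (L t.toNNReal)) lam = Complex.exp (t * k) := by
    intro lam
    refine exists_eq_exp_mul_of_continuous (φ := fun t => charFun (P.map (L t.toNNReal)) lam)
      ?_ ?_ ?_
    · have hc : Continuous fun t : ℝ≥0 => charFun (P.map (L t)) lam :=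
        continuous_iff_continuousAt.2 fun t => tendsto_charFun_of_tendstoInMeasure
          (hL.stochastically_continuous t) (fun s => (hL.measurable s).aemeasurable)
          (hL.measurable t).aemeasurable lam
      exact hc.comp continuous_real_toNNReal
    · simpa using hL.charFun_zero_time lam
    · intro s t hs ht
      simp only [Real.toNNReal_add hs ht]
      exact hL.charFun_add _ _ _
  choose Ψ hΨ using hex
  refine ⟨Ψ, fun t lam => ?_, fun Φ hΦ => ?_⟩
  · simpa using hΨ lam t t.2
  · ext1 lam
    refine eq_of_forall_cexp_mul_eq fun t ht => ?_
    rw [← hΨ lam t ht, hΦ, Real.coe_toNNReal t ht]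

lemma IsCumulant.norm_exp_le_one {Ψ : ℝ → ℂ} (h : IsCumulant L P Ψ)
    (hL : ∀ t, AEMeasurable (L t) P) {t : ℝ} (ht : 0 ≤ t) (lam : ℝ) :
    ‖Complex.exp (t * Ψ lam)‖ ≤ 1 := by
  have := Measure.isProbabilityMeasure_map (hL ⟨t, ht⟩)
  have h2 : charFun (P.map (L ⟨t, ht⟩)) lam = Complex.exp (t * Ψ lam) := h ⟨t, ht⟩ lam
  exact h2 ▸ norm_charFun_le_one (μ := P.map (L ⟨t, ht⟩)) lam

/-- Integrating in time gives `Ψ * ∫_0^T exp (t Ψ) dt = exp (T Ψ) - 1`. The integral is continuous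
in `lam` by dominated convergence and is nonzero at `lam₀` for some small `T`, so `Ψ` is locally a
quotient of continuous functions; no branch of the logarithm has to be chosen. -/
lemma IsCumulant.continuous {Ψ : ℝ → ℂ} (h : IsCumulant L P Ψ)
    (hL : ∀ t, AEMeasurable (L t) P) : Continuous Ψ := by
  have hexp : ∀ t : ℝ, 0 ≤ t → Continuous fun lam => Complex.exp (t * Ψ lam) := by
    intro t ht
    have := Measure.isProbabilityMeasure_map (hL ⟨t, ht⟩)
    have h2 : ∀ lam, charFun (P.map (L ⟨t, ht⟩)) lam = Complex.exp (t * Ψ lam) := h ⟨t, ht⟩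
    rw [← funext h2]
    exact continuous_charFun
  refine continuous_iff_continuousAt.2 fun lam₀ => ?_
  have hcont : ∀ lam : ℝ, Continuous fun t : ℝ => Complex.exp (t * Ψ lam) := fun lam => by fun_prop
  obtain ⟨T, hT0, hT⟩ : ∃ T : ℝ, (∫ t in (0 : ℝ)..T, Complex.exp (t * Ψ lam₀)) ≠ 0 ∧ 0 < T := by
    have hd : HasDerivAt (fun T => ∫ t in (0 : ℝ)..T, Complex.exp (t * Ψ lam₀))
        (Complex.exp ((0 : ℝ) * Ψ lam₀)) 0 :=
      intervalIntegral.integral_hasDerivAt_right ((hcont lam₀).intervalIntegrable _ _)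
        ((hcont lam₀).stronglyMeasurableAtFilter _ _) (hcont lam₀).continuousAt
    have h2 := (hd.eventually_ne (c := 0) (by simp)).filter_mono (nhdsGT_le_nhdsNE 0)
    obtain ⟨t, ht1, ht2⟩ := (h2.and self_mem_nhdsWithin).exists
    exact ⟨t, ht1, ht2⟩
  set F : ℝ → ℂ := fun lam => ∫ t in (0 : ℝ)..T, Complex.exp (t * Ψ lam) with hF
  have hFc : Continuous F := by
    refine intervalIntegral.continuous_of_dominated_interval (bound := fun _ => 1)
      (fun lam => (hcont lam).aestronglyMeasurable) (fun lam => ?_) intervalIntegrable_const ?_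
    · refine Eventually.of_forall fun t ht => ?_
      rw [uIoc_of_le hT.le] at ht
      exact h.norm_exp_le_one hL ht.1.le lam
    · refine Eventually.of_forall fun t ht => ?_
      rw [uIoc_of_le hT.le] at ht
      exact hexp t ht.1.le
  have hFeq : ∀ lam, F lam * Ψ lam = Complex.exp (T * Ψ lam) - 1 := by
    intro lam
    have := intervalIntegral.integral_eq_sub_of_hasDerivAt (a := 0) (b := T)
      (fun t _ => hasDerivAt_cexp_ofReal_mul (Ψ lam) t)
      (((hcont lam).mul continuous_const).intervalIntegrable _ _)
    rw [intervalIntegral.integral_mul_const] at this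
    simpa using this
  have hev : Ψ =ᶠ[𝓝 lam₀] fun lam => (Complex.exp (T * Ψ lam) - 1) / F lam := by
    filter_upwards [hFc.continuousAt.eventually_ne hT0] with lam hlam
    rw [← hFeq, mul_div_cancel_left₀ _ hlam]
  refine ContinuousAt.congr ?_ hev.symm
  exact (((hexp T hT.le).sub continuous_const).continuousAt).div hFc.continuousAt hT0

/-- Continuity keeps the imaginary part of `t Ψ(lam) - t Ψ(lam₀)` within `(-π, π)` near `lam₀`, so
the principal logarithm of the quotient of exponentials recovers it, and that logarithm is smooth at
1. -/
lemma contDiff_of_contDiff_cexp_mul {Ψ : ℝ → ℂ} (hΨ : Continuous Ψ) {t : ℝ} (ht : t ≠ 0) {n : ℕ∞}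
    (h : ContDiff ℝ n fun lam => Complex.exp (t * Ψ lam)) : ContDiff ℝ n Ψ := by
  refine contDiff_iff_contDiffAt.2 fun lam₀ => ?_
  set z : ℝ → ℂ := fun lam => t * Ψ lam - t * Ψ lam₀ with hz
  have hz0 : z lam₀ = 0 := sub_self _
  have hzc : ContinuousAt (fun lam => (z lam).im) lam₀ :=
    (Complex.continuous_im.comp (by fun_prop)).continuousAt
  have hmem : ∀ᶠ lam in 𝓝 lam₀, (z lam).im ∈ Ioo (-Real.pi) Real.pi :=
    hzc.eventually (Ioo_mem_nhds (by simp [hz0, Real.pi_pos]) (by simp [hz0, Real.pi_pos]))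
  have hev : Ψ =ᶠ[𝓝 lam₀] fun lam => (t : ℂ)⁻¹ *
      Complex.log (Complex.exp (t * Ψ lam) / Complex.exp (t * Ψ lam₀)) + Ψ lam₀ := by
    filter_upwards [hmem] with lam hlam
    rw [← Complex.exp_sub, Complex.log_exp hlam.1 hlam.2.le]
    have : (t : ℂ) ≠ 0 := by exact_mod_cast ht
    field_simp
    ring
  refine ContDiffAt.congr_of_eventuallyEq ?_ hev
  refine (contDiffAt_const.mul ?_).add contDiffAt_const
  have hlog : ContDiffAt ℝ n Complex.log
      (Complex.exp (t * Ψ lam₀) / Complex.exp (t * Ψ lam₀)) := by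
    rw [div_self (Complex.exp_ne_zero _)]
    exact (Complex.contDiffAt_log (by simp)).restrict_scalars ℝ
  exact hlog.comp lam₀ (h.contDiffAt.div_const _)

end Cumulant

/-! ### Characteristic functions and moments -/

section Moments

variable {μ : Measure ℝ} [IsProbabilityMeasure μ]

lemma re_charFun_eq_integral_cos (t : ℝ) : (charFun μ t).re = ∫ x, Real.cos (t * x) ∂μ := by
  rw [charFun_apply_real, ← RCLike.re_eq_complex_re, ← integral_re]
  · refine integral_congr_ae (Eventually.of_forall fun x => ?_)
    simp only [RCLike.re_eq_complex_re]
    rw [← Complex.ofReal_mul, Complex.exp_ofReal_mul_I_re]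
  · refine (integrable_const (1 : ℝ)).mono' (by fun_prop) (Eventually.of_forall fun x => ?_)
    rw [← Complex.ofReal_mul, Complex.norm_exp_ofReal_mul_I]

/-- A probability measure with twice continuously differentiable characteristic function has a
finite second moment. -/
theorem memLp_id_two_of_contDiff_charFun (h : ContDiff ℝ 2 (charFun μ)) : MemLp id 2 μ := by
  set g : ℝ → ℝ := fun t => (charFun μ t).re with hg
  have hgc : ContDiff ℝ 2 g := Complex.reCLM.contDiff.comp h
  have hg0 : g 0 = 1 := by simp [hg]
  have heven : ∀ t, g (-t) = g t := fun t => by simp [hg, charFun_neg]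
  -- The real part of a characteristic function is even, so the linear Taylor term vanishes and `1 -
  -- g t = O(t²)`.
  have hd0 : deriv g 0 = 0 := by
    have h1 : deriv (fun t => g (-t)) 0 = -deriv g (-0) := deriv_comp_neg g 0
    rw [funext heven, neg_zero] at h1
    linarith
  obtain ⟨C, hC⟩ := exists_taylor_mean_remainder_bound (n := 1) zero_le_one
    (by exact_mod_cast hgc.contDiffOn (s := Icc (0 : ℝ) 1))
  have hbound : ∀ t ∈ Icc (0 : ℝ) 1, |g t - 1| ≤ C * t ^ 2 := by
    intro t ht
    have := hC t ht
    rw [taylorWithinEval_succ, taylor_within_zero_eval, iteratedDerivWithin_one,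
      ((hgc.differentiable (by norm_num)) 0).derivWithin
        ((uniqueDiffOn_Icc zero_lt_one) 0 (by simp)), hd0, hg0] at this
    simpa using this
  set s : ℕ → ℝ := fun n => 1 / ((n : ℝ) + 1) with hs
  have hs0 : ∀ n, 0 < s n := fun n => by positivity
  have hs1 : ∀ n, s n ≤ 1 := fun n => by
    rw [hs, div_le_one (by positivity)]
    simp
  have hst : Tendsto s atTop (𝓝 0) := tendsto_one_div_add_atTop_nhds_zero_nat
  -- Nonnegative second difference quotients converging to `x²`. Their integrals `2 (1 - g (s n)) /
  -- (s n)²` are at most `2 C`, and Fatou's lemma concludes.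
  set f : ℕ → ℝ → ℝ := fun n x => 2 * (1 - Real.cos (s n * x)) / s n ^ 2 with hf
  have hf0 : ∀ n x, 0 ≤ f n x := fun n x => by
    have := Real.cos_le_one (s n * x)
    have h3 := hs0 n
    exact div_nonneg (by linarith) (by positivity)
  have hfi : ∀ n, Integrable (fun x => Real.cos (s n * x)) μ := fun n =>
    (integrable_const (1 : ℝ)).mono' (by fun_prop)
      (Eventually.of_forall fun x => Real.abs_cos_le_one _)
  have hflim : ∀ x, Tendsto (fun n => f n x) atTop (𝓝 (x ^ 2)) := by
    intro x
    have h1 : ∀ n, f n x = x ^ 2 * Real.sinc (s n * x / 2) ^ 2 := by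
      intro n
      have e1 : 1 - Real.cos (s n * x) = 2 * Real.sin (s n * x / 2) ^ 2 := by
        rw [Real.sin_sq_eq_half_sub, mul_div_cancel₀ _ two_ne_zero]
        ring
      have e2 : Real.sin (s n * x / 2) = s n * x / 2 * Real.sinc (s n * x / 2) := by
        rcases eq_or_ne (s n * x / 2) 0 with h | h
        · simp [h]
        · rw [Real.sinc_of_ne_zero h, mul_div_cancel₀ _ h]
      have e3 := (hs0 n).ne'
      rw [hf]
      simp only
      rw [e1, e2]
      field_simp
    simp_rw [h1]
    have h2 : Tendsto (fun n => s n * x / 2) atTop (𝓝 0) := by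
      simpa using (hst.mul_const x).div_const 2
    have h3 := (Real.continuous_sinc.tendsto 0).comp h2
    simpa [Function.comp_def] using (h3.pow 2).const_mul (x ^ 2)
  have hfint : ∀ n, ∫⁻ x, ENNReal.ofReal (f n x) ∂μ ≤ ENNReal.ofReal (2 * C) := by
    intro n
    have hint : Integrable (f n) μ :=
      (((integrable_const (1 : ℝ)).sub (hfi n)).const_mul 2).div_const _
    rw [← ofReal_integral_eq_lintegral_ofReal hint (Eventually.of_forall (hf0 n))]
    refine ENNReal.ofReal_le_ofReal ?_
    simp only [hf]
    rw [integral_div, integral_const_mul, integral_sub (integrable_const _) (hfi n),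
      ← re_charFun_eq_integral_cos, integral_const, div_le_iff₀ (by have := hs0 n; positivity)]
    have := hbound (s n) ⟨(hs0 n).le, hs1 n⟩
    rw [abs_le] at this
    simp only [probReal_univ, smul_eq_mul, mul_one]
    simp only [hg] at this
    linarith [this.1]
  have hmeas : AEStronglyMeasurable (id : ℝ → ℝ) μ := by fun_prop
  refine (memLp_two_iff_integrable_sq hmeas).2 ⟨by fun_prop, ?_⟩
  have hfatou : ∫⁻ x, ENNReal.ofReal (x ^ 2) ∂μ ≤ ENNReal.ofReal (2 * C) := by
    calc ∫⁻ x, ENNReal.ofReal (x ^ 2) ∂μ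
        = ∫⁻ x, liminf (fun n => ENNReal.ofReal (f n x)) atTop ∂μ := by
          refine lintegral_congr fun x => ?_
          exact ((ENNReal.continuous_ofReal.tendsto _).comp (hflim x)).liminf_eq.symm
      _ ≤ liminf (fun n => ∫⁻ x, ENNReal.ofReal (f n x) ∂μ) atTop :=
          lintegral_liminf_le fun n => by fun_prop
      _ ≤ _ := liminf_le_of_frequently_le' (Frequently.of_forall hfint)
  rw [hasFiniteIntegral_iff_ofReal (Eventually.of_forall fun x => sq_nonneg _)]
  exact hfatou.trans_lt ENNReal.ofReal_lt_top

variable {Ψ : ℝ → ℂ} {t : ℝ}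

lemma hasDerivAt_cexp_mul_comp (hΨ : ContDiff ℝ 2 Ψ) (lam : ℝ) :
    HasDerivAt (fun lam => Complex.exp (t * Ψ lam))
      (Complex.exp (t * Ψ lam) * (t * deriv Ψ lam)) lam :=
  (((hΨ.differentiable (by norm_num)) lam).hasDerivAt.const_mul (t : ℂ)).cexp

lemma integral_id_of_charFun_eq_cexp (hΨ : ContDiff ℝ 2 Ψ) (hint : MemLp id 2 μ)
    (h : ∀ lam, charFun μ lam = Complex.exp (t * Ψ lam)) :
    ((∫ x, x ∂μ : ℝ) : ℂ) = t * (-Complex.I * deriv Ψ 0) := by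
  have h1 := iteratedDeriv_charFun_zero (n := 1) (hint.mono_exponent (by norm_num))
  -- Only `exp (t Ψ(0)) = 1` is needed here, not `Ψ(0) = 0`.
  have h0 := h 0
  rw [charFun_zero, probReal_univ, Complex.ofReal_one] at h0
  rw [iteratedDeriv_one, funext h, (hasDerivAt_cexp_mul_comp hΨ 0).deriv, ← h0] at h1
  simp only [pow_one, one_mul] at h1
  rw [show (t : ℂ) * (-Complex.I * deriv Ψ 0) = -Complex.I * (t * deriv Ψ 0) by ring, h1,
    ← mul_assoc]
  simp

lemma integral_sq_of_charFun_eq_cexp (hΨ : ContDiff ℝ 2 Ψ) (hint : MemLp id 2 μ)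
    (h : ∀ lam, charFun μ lam = Complex.exp (t * Ψ lam)) :
    ((∫ x, x ^ 2 ∂μ : ℝ) : ℂ) = t * (-iteratedDeriv 2 Ψ 0) - (t * deriv Ψ 0) ^ 2 := by
  have h1 := iteratedDeriv_charFun_zero (n := 2) hint
  have h0 := h 0
  rw [charFun_zero, probReal_univ, Complex.ofReal_one] at h0
  have hd : deriv (charFun μ) = fun lam => Complex.exp (t * Ψ lam) * (t * deriv Ψ lam) := by
    rw [funext h]
    exact funext fun lam => (hasDerivAt_cexp_mul_comp hΨ lam).deriv
  have hd2 : HasDerivAt (deriv Ψ) (iteratedDeriv 2 Ψ 0) 0 := by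
    rw [iteratedDeriv_succ, iteratedDeriv_one]
    refine DifferentiableAt.hasDerivAt ?_
    exact (hΨ.differentiable_deriv_two) 0
  have hd3 := (hasDerivAt_cexp_mul_comp (t := t) hΨ 0).fun_mul (hd2.const_mul (t : ℂ))
  rw [iteratedDeriv_succ, iteratedDeriv_one, hd, hd3.deriv, ← h0, Complex.I_sq] at h1
  linear_combination h1

end Moments

/-! ### The Wiener integral as a scaled isometry -/

/-- Two families in Hilbert spaces whose Gram matrices are proportional, the first of them total,
are related by a multiple of an isometry. -/
theorem exists_continuousLinearMap_of_inner_eq {ι F G : Type*}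
    [NormedAddCommGroup F] [InnerProductSpace ℝ F]
    [NormedAddCommGroup G] [InnerProductSpace ℝ G] [CompleteSpace G] {u : ι → F} {w : ι → G}
    {v : ℝ} (hv : 0 ≤ v) (hinner : ∀ i j, inner ℝ (w i) (w j) = v * inner ℝ (u i) (u j))
    (hdense : (Submodule.span ℝ (range u)).topologicalClosure = ⊤) :
    ∃ W : F →L[ℝ] G, (∀ i, W (u i) = w i) ∧ (∀ x y, inner ℝ (W x) (W y) = v * inner ℝ x y) ∧
      ∀ z, (∀ i, inner ℝ (w i) z = 0) → ∀ x, inner ℝ (W x) z = 0 := by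
  set e : (ι →₀ ℝ) →ₗ[ℝ] F := Finsupp.linearCombination ℝ u with he
  set f : (ι →₀ ℝ) →ₗ[ℝ] G := Finsupp.linearCombination ℝ w with hf
  have hfe : ∀ x y, inner ℝ (f x) (f y) = v * inner ℝ (e x) (e y) := by
    intro x y
    simp only [he, hf, Finsupp.linearCombination_apply, Finsupp.sum, sum_inner, inner_sum,
      real_inner_smul_left, real_inner_smul_right, hinner, Finset.mul_sum]
    refine Finset.sum_congr rfl fun i _ => Finset.sum_congr rfl fun j _ => ?_
    ring
  -- This bound makes `e x ↦ f x` well defined and bounded on the dense range of `e`, so that it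
  -- extends to `F`.
  have hnorm : ∀ x, ‖f x‖ ≤ √v * ‖e x‖ := by
    intro x
    refine le_of_sq_le_sq ?_ (by positivity)
    rw [mul_pow, Real.sq_sqrt hv, ← real_inner_self_eq_norm_sq, ← real_inner_self_eq_norm_sq, hfe]
  have hde : DenseRange e := by
    have h1 : (LinearMap.range e).topologicalClosure = ⊤ := by
      rw [he, Finsupp.range_linearCombination, hdense]
    have := Submodule.dense_iff_topologicalClosure_eq_top.2 h1
    rwa [LinearMap.coe_range] at this
  have hW : ∀ x, f.extendOfNorm e (e x) = f x := fun x =>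
    LinearMap.extendOfNorm_eq hde ⟨_, hnorm⟩ x
  refine ⟨f.extendOfNorm e, fun i => ?_, fun x y => ?_, fun z hz x => ?_⟩
  · have := hW (Finsupp.single i 1)
    simpa [he, hf] using this
  · refine hde.induction_on₂ (p := fun x y => inner ℝ (f.extendOfNorm e x) (f.extendOfNorm e y)
      = v * inner ℝ x y) ?_ ?_ x y
    · exact isClosed_eq (by fun_prop) (by fun_prop)
    · intro a b
      rw [hW, hW, hfe]
  · refine hde.induction_on (p := fun x => inner ℝ (f.extendOfNorm e x) z = 0) x ?_ ?_
    · exact isClosed_eq (by fun_prop) (by fun_prop)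
    · intro a
      rw [hW]
      simp [hf, Finsupp.linearCombination_apply, Finsupp.sum, sum_inner,
        real_inner_smul_left, hz]

/-- Lebesgue measure on the half-line `(0, ∞)`. -/
noncomputable abbrev volIoi : Measure ℝ := volume.restrict (Ioi 0)

lemma volIoi_Ioc_ne_top (a b : ℝ) : volIoi (Ioc a b) ≠ ⊤ :=
  ((Measure.restrict_apply_le _ _).trans_lt measure_Ioc_lt_top).ne

lemma volIoi_restrict_Ioc {a : ℝ} (ha : 0 ≤ a) (b : ℝ) :
    volIoi.restrict (Ioc a b) = volume.restrict (Ioc a b) := by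
  rw [Measure.restrict_restrict measurableSet_Ioc, inter_eq_left.2]
  exact fun x hx => ha.trans_lt hx.1

/-- The indicator function of `(0, t]` as an element of `L²(0, ∞)`. -/
noncomputable def indicatorIoc (t : ℝ≥0) : Lp ℝ 2 volIoi :=
  indicatorConstLp 2 (measurableSet_Ioc (a := (0 : ℝ)) (b := t)) (volIoi_Ioc_ne_top 0 t) (1 : ℝ)

lemma inner_indicatorIoc (s t : ℝ≥0) :
    inner ℝ (indicatorIoc s) (indicatorIoc t) = min (s : ℝ) t := by
  rw [indicatorIoc, indicatorIoc, L2.real_inner_indicatorConstLp_one_indicatorConstLp_one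
      measurableSet_Ioc measurableSet_Ioc (volIoi_Ioc_ne_top _ _) (volIoi_Ioc_ne_top _ _),
    Ioc_inter_Ioc, max_self, measureReal_restrict_apply measurableSet_Ioc, inter_eq_left.2,
    Real.volume_real_Ioc_of_le, sub_zero]
  · exact le_min s.coe_nonneg t.coe_nonneg
  · exact fun x hx => hx.1

/-- A function orthogonal to every indicator of `(0, t]` has vanishing primitive, hence is zero
almost everywhere by Lebesgue differentiation. -/
theorem span_indicatorIoc_topologicalClosure :
    (Submodule.span ℝ (range indicatorIoc)).topologicalClosure = ⊤ := by
  rw [Submodule.topologicalClosure_eq_top_iff, Submodule.eq_bot_iff]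
  intro g hg
  rw [Submodule.mem_orthogonal] at hg
  have hint : ∀ t : ℝ, 0 ≤ t → ∫ x in (0 : ℝ)..t, g x = 0 := by
    intro t ht
    have := hg (indicatorIoc ⟨t, ht⟩) (Submodule.subset_span (mem_range_self _))
    change inner ℝ (indicatorConstLp 2 measurableSet_Ioc (volIoi_Ioc_ne_top 0 t) (1 : ℝ)) g = 0
      at this
    rw [L2.inner_indicatorConstLp_one, volIoi_restrict_Ioc le_rfl] at this
    rwa [intervalIntegral.integral_of_le ht]
  have hloc : LocallyIntegrable ((Ioi (0 : ℝ)).indicator g) volume := by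
    refine (locallyIntegrable_iff).2 fun K hK => ?_
    rw [IntegrableOn, integrable_indicator_iff measurableSet_Ioi, IntegrableOn,
      Measure.restrict_restrict measurableSet_Ioi, inter_comm,
      ← Measure.restrict_restrict hK.measurableSet]
    exact integrableOn_Lp_of_measure_ne_top g fact_one_le_two_ennreal.elim
      ((Measure.restrict_apply_le _ _).trans_lt hK.measure_lt_top).ne
  have hind : ∀ t : ℝ, 0 ≤ t → ∫ x in (0 : ℝ)..t, (Ioi (0 : ℝ)).indicator g x = 0 := by
    intro t ht
    refine (?_ : _ = _).trans (hint t ht)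
    refine intervalIntegral.integral_congr_ae (Eventually.of_forall fun x hx => ?_)
    rw [uIoc_of_le ht] at hx
    exact indicator_of_mem hx.1 _
  rw [Lp.eq_zero_iff_ae_eq_zero]
  refine (ae_restrict_iff' measurableSet_Ioi).2 ?_
  filter_upwards [LocallyIntegrable.ae_hasDerivAt_integral hloc] with x hx hx0
  have h1 := hx 0
  have h2 : (fun y => ∫ t in (0 : ℝ)..y, (Ioi (0 : ℝ)).indicator g t) =ᶠ[𝓝 x] fun _ => 0 := by
    filter_upwards [Ioi_mem_nhds hx0] with y hy using hind y (le_of_lt hy)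
  have h3 := (h1.congr_of_eventuallyEq h2.symm).unique (hasDerivAt_const x (0 : ℝ))
  rwa [indicator_of_mem hx0] at h3

/-- The increments of `Y` on `[0, ∞)` are independent, square integrable, and those over `[a, b]`
have the characteristic function `exp ((b - a) Ψ)`, the mean `(b - a) m` and the variance
`(b - a) v`. -/
structure HasLevyIncrements {Ω : Type*} [MeasurableSpace Ω] (Y : ℝ → Ω → ℝ) (P : Measure Ω)
    (Ψ : ℝ → ℂ) (m v : ℝ) : Prop where
  variance_nonneg : 0 ≤ v
  measurable : ∀ t, Measurable (Y t)
  indep : ∀ t : ℕ → ℝ, Monotone t → 0 ≤ t 0 →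
    iIndepFun (fun (i : ℕ) ω => Y (t (i + 1)) ω - Y (t i) ω) P
  charFun_sub : ∀ a b, 0 ≤ a → a ≤ b → ∀ lam,
    charFun (P.map fun ω => Y b ω - Y a ω) lam = Complex.exp (((b - a : ℝ) : ℂ) * Ψ lam)
  memLp_sub : ∀ a b, 0 ≤ a → a ≤ b → MemLp (fun ω => Y b ω - Y a ω) 2 P
  integral_sub : ∀ a b, 0 ≤ a → a ≤ b → ∫ ω, Y b ω - Y a ω ∂P = (b - a) * m
  integral_sub_sq : ∀ a b, 0 ≤ a → a ≤ b →
    ∫ ω, (Y b ω - Y a ω) ^ 2 ∂P = (b - a) * v + ((b - a) * m) ^ 2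

namespace HasLevyIncrements

variable {Ω : Type*} [MeasurableSpace Ω] {P : Measure Ω}
  {Y : ℝ → Ω → ℝ} {Ψ : ℝ → ℂ} {m v : ℝ}

lemma indepFun_sub_sub (hY : HasLevyIncrements Y P Ψ m v) {r s t : ℝ} (hr : 0 ≤ r)
    (hrs : r ≤ s) (hst : s ≤ t) :
    (fun ω => Y s ω - Y r ω) ⟂ᵢ[P] (fun ω => Y t ω - Y s ω) := by
  let τ : ℕ → ℝ
    | 0 => r
    | 1 => s
    | _ => t
  have hτ : Monotone τ := monotone_nat_of_le_succ fun n => by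
    match n with
    | 0 => exact hrs
    | 1 => exact hst
    | n + 2 => exact le_rfl
  exact (hY.indep τ hτ hr).indepFun (by decide : (0 : ℕ) ≠ 1)

variable [IsProbabilityMeasure P]

lemma memLp_centered (hY : HasLevyIncrements Y P Ψ m v) {a b : ℝ} (ha : 0 ≤ a) (hab : a ≤ b) :
    MemLp (fun ω => Y b ω - Y a ω - (b - a) * m) 2 P :=
  (hY.memLp_sub a b ha hab).sub (memLp_const _)

lemma integral_centered (hY : HasLevyIncrements Y P Ψ m v) {a b : ℝ} (ha : 0 ≤ a) (hab : a ≤ b) :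
    ∫ ω, Y b ω - Y a ω - (b - a) * m ∂P = 0 := by
  rw [MeasureTheory.integral_sub ((hY.memLp_sub a b ha hab).integrable one_le_two)
    (integrable_const _), hY.integral_sub a b ha hab]
  simp

lemma integral_centered_sq (hY : HasLevyIncrements Y P Ψ m v) {a b : ℝ} (ha : 0 ≤ a)
    (hab : a ≤ b) : ∫ ω, (Y b ω - Y a ω - (b - a) * m) ^ 2 ∂P = (b - a) * v := by
  have h1 := hY.memLp_sub a b ha hab
  have : ∀ ω, (Y b ω - Y a ω - (b - a) * m) ^ 2 = (Y b ω - Y a ω) ^ 2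
      - 2 * ((b - a) * m) * (Y b ω - Y a ω) + ((b - a) * m) ^ 2 := fun ω => by ring
  simp_rw [this]
  have i1 := h1.integrable_sq
  have i2 := (h1.integrable one_le_two).const_mul (2 * ((b - a) * m))
  rw [integral_add (f := fun ω => (Y b ω - Y a ω) ^ 2 - 2 * ((b - a) * m) * (Y b ω - Y a ω))
    (i1.sub i2) (integrable_const _), MeasureTheory.integral_sub i1 i2,
    integral_const_mul, hY.integral_sub a b ha hab, hY.integral_sub_sq a b ha hab]
  simp
  ring

/-- Split the increment over `[0, t]` at `s`: the part after `s` is independent of the part before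
and centred, so only the variance on `[0, s]` survives. -/
lemma integral_centered_mul_centered (hY : HasLevyIncrements Y P Ψ m v) {s t : ℝ} (hs : 0 ≤ s)
    (hst : s ≤ t) :
    ∫ ω, (Y s ω - Y 0 ω - (s - 0) * m) * (Y t ω - Y 0 ω - (t - 0) * m) ∂P = s * v := by
  have hi := (hY.indepFun_sub_sub le_rfl hs hst).comp
    (measurable_id.sub_const ((s - 0) * m)) (measurable_id.sub_const ((t - s) * m))
  simp only [Function.comp_def, id] at hi
  have h1 := hY.memLp_centered le_rfl hs
  have h2 := hY.memLp_centered hs hst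
  have h3 := hi.integral_fun_mul_eq_mul_integral h1.1 h2.1
  rw [hY.integral_centered le_rfl hs, zero_mul] at h3
  have : ∀ ω, (Y s ω - Y 0 ω - (s - 0) * m) * (Y t ω - Y 0 ω - (t - 0) * m)
      = (Y s ω - Y 0 ω - (s - 0) * m) ^ 2
        + (Y s ω - Y 0 ω - (s - 0) * m) * (Y t ω - Y s ω - (t - s) * m) := fun ω => by ring
  simp_rw [this]
  rw [integral_add h1.integrable_sq (show Integrable (fun ω => _ * _) P from h1.integrable_mul h2),
    h3,
    hY.integral_centered_sq le_rfl hs]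
  ring

/-- The centred process as a curve in `L²(P)`. -/
noncomputable def centeredLp (hY : HasLevyIncrements Y P Ψ m v) (t : ℝ≥0) : Lp ℝ 2 P :=
  (hY.memLp_centered le_rfl t.coe_nonneg).toLp _

lemma inner_centeredLp (hY : HasLevyIncrements Y P Ψ m v) (s t : ℝ≥0) :
    inner ℝ (hY.centeredLp s) (hY.centeredLp t)
      = v * inner ℝ (indicatorIoc s) (indicatorIoc t) := by
  wlog hst : s ≤ t generalizing s t
  · rw [real_inner_comm, this t s (le_of_not_ge hst), real_inner_comm]
  rw [inner_indicatorIoc, min_eq_left (by exact_mod_cast hst), mul_comm,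
    ← hY.integral_centered_mul_centered s.coe_nonneg (NNReal.coe_le_coe.2 hst), L2.inner_def]
  refine integral_congr_ae ?_
  filter_upwards [(hY.memLp_centered le_rfl s.coe_nonneg).coeFn_toLp,
    (hY.memLp_centered le_rfl t.coe_nonneg).coeFn_toLp] with ω h1 h2
  rw [centeredLp, centeredLp]
  rw [h1, h2]
  simp [mul_comm]

lemma inner_centeredLp_const (hY : HasLevyIncrements Y P Ψ m v) (t : ℝ≥0) :
    inner ℝ (hY.centeredLp t) (Lp.const 2 P (1 : ℝ)) = 0 := by
  rw [L2.inner_def, ← hY.integral_centered le_rfl t.coe_nonneg]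
  refine integral_congr_ae ?_
  filter_upwards [(hY.memLp_centered le_rfl t.coe_nonneg).coeFn_toLp,
    Lp.coeFn_const (p := 2) (μ := P) (1 : ℝ)] with ω h1 h2
  rw [h2, centeredLp, h1]
  simp

theorem exists_wienerMap (hY : HasLevyIncrements Y P Ψ m v) :
    ∃ W : Lp ℝ 2 volIoi →L[ℝ] Lp ℝ 2 P,
      (∀ t : ℝ≥0, W (indicatorIoc t) = hY.centeredLp t) ∧
      (∀ x y, inner ℝ (W x) (W y) = v * inner ℝ x y) ∧
      ∀ x, inner ℝ (W x) (Lp.const 2 P (1 : ℝ)) = 0 := by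
  obtain ⟨W, h1, h2, h3⟩ := exists_continuousLinearMap_of_inner_eq hY.variance_nonneg
    hY.inner_centeredLp span_indicatorIoc_topologicalClosure
  exact ⟨W, h1, h2, h3 _ hY.inner_centeredLp_const⟩

/-- The Wiener integral with respect to the centred process. -/
noncomputable def wienerMap (hY : HasLevyIncrements Y P Ψ m v) :
    Lp ℝ 2 volIoi →L[ℝ] Lp ℝ 2 P := hY.exists_wienerMap.choose

lemma wienerMap_indicatorIoc (hY : HasLevyIncrements Y P Ψ m v) (t : ℝ≥0) :
    hY.wienerMap (indicatorIoc t) = hY.centeredLp t := hY.exists_wienerMap.choose_spec.1 t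

lemma inner_wienerMap (hY : HasLevyIncrements Y P Ψ m v) (x y : Lp ℝ 2 volIoi) :
    inner ℝ (hY.wienerMap x) (hY.wienerMap y) = v * inner ℝ x y :=
  hY.exists_wienerMap.choose_spec.2.1 x y

lemma inner_wienerMap_const (hY : HasLevyIncrements Y P Ψ m v) (x : Lp ℝ 2 volIoi) :
    inner ℝ (hY.wienerMap x) (Lp.const 2 P (1 : ℝ)) = 0 :=
  hY.exists_wienerMap.choose_spec.2.2 x

end HasLevyIncrements

/-! ### Integrands and step functions -/

/-- Integrands of the integral with respect to a Lévy process on `[0, ∞)`. -/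
structure IsLevyIntegrand (g : ℝ → ℝ) : Prop where
  integrable : Integrable g volIoi
  memLp : MemLp g 2 volIoi

namespace IsLevyIntegrand

variable {g h : ℝ → ℝ}

lemma add (hg : IsLevyIntegrand g) (hh : IsLevyIntegrand h) : IsLevyIntegrand (g + h) :=
  ⟨hg.1.add hh.1, hg.2.add hh.2⟩

lemma sub (hg : IsLevyIntegrand g) (hh : IsLevyIntegrand h) : IsLevyIntegrand (g - h) :=
  ⟨hg.1.sub hh.1, hg.2.sub hh.2⟩

lemma const_smul (hg : IsLevyIntegrand g) (c : ℝ) : IsLevyIntegrand (c • g) :=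
  ⟨hg.1.smul c, hg.2.const_smul c⟩

lemma zero : IsLevyIntegrand 0 := ⟨integrable_zero _ _ _, MemLp.zero⟩

lemma sum {ι : Type*} (s : Finset ι) {g : ι → ℝ → ℝ} (hg : ∀ i ∈ s, IsLevyIntegrand (g i)) :
    IsLevyIntegrand (∑ i ∈ s, g i) := by
  classical
  induction s using Finset.induction_on with
  | empty => simpa using zero
  | insert a s ha ih =>
    rw [Finset.sum_insert ha]
    exact (hg a (Finset.mem_insert_self _ _)).add
      (ih fun i hi => hg i (Finset.mem_insert_of_mem hi))

lemma indicator_Ioc (hg : Continuous g) (a b : ℝ) : IsLevyIntegrand ((Ioc a b).indicator g) := by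
  obtain ⟨C, hC⟩ := (isCompact_Icc (a := a) (b := b)).exists_bound_of_continuousOn hg.continuousOn
  have hfin : IsFiniteMeasure (volIoi.restrict (Ioc a b)) :=
    ⟨by rw [Measure.restrict_apply_univ]; exact (volIoi_Ioc_ne_top a b).lt_top⟩
  have hb : ∀ᵐ x ∂volIoi.restrict (Ioc a b), ‖g x‖ ≤ C :=
    (ae_restrict_iff' measurableSet_Ioc).2
      (Eventually.of_forall fun x hx => hC x (Ioc_subset_Icc_self hx))
  have h2 : MemLp g 2 (volIoi.restrict (Ioc a b)) :=
    MemLp.of_bound hg.aestronglyMeasurable C hb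
  refine ⟨?_, (memLp_indicator_iff_restrict measurableSet_Ioc).2 h2⟩
  exact (integrable_indicator_iff measurableSet_Ioc).2 (h2.integrable one_le_two)

end IsLevyIntegrand

/-- The step function `∑ h(ξ_k) 1_(t_k, t_{k+1}]`. -/
noncomputable def stepFun (h : ℝ → ℝ) (t ξ : ℕ → ℝ) (N : ℕ) : ℝ → ℝ :=
  ∑ k ∈ Finset.range N, h (ξ k) • (Ioc (t k) (t (k + 1))).indicator (1 : ℝ → ℝ)

lemma isLevyIntegrand_stepFun (h : ℝ → ℝ) (t ξ : ℕ → ℝ) (N : ℕ) :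
    IsLevyIntegrand (stepFun h t ξ N) :=
  IsLevyIntegrand.sum _ fun _ _ =>
    (IsLevyIntegrand.indicator_Ioc continuous_const _ _).const_smul _

lemma stepFun_apply_of_mem {h : ℝ → ℝ} {t ξ : ℕ → ℝ} {N k : ℕ} (ht : Monotone t) (hk : k < N)
    {r : ℝ} (hr : r ∈ Ioc (t k) (t (k + 1))) : stepFun h t ξ N r = h (ξ k) := by
  rw [stepFun, Finset.sum_apply, Finset.sum_eq_single_of_mem k (Finset.mem_range.2 hk)]
  · simp [indicator_of_mem hr]
  · intro j _ hjk
    have : r ∉ Ioc (t j) (t (j + 1)) := fun hj =>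
      disjoint_left.1 (ht.pairwise_disjoint_on_Ioc_succ hjk) hj hr
    simp [indicator_of_notMem this]

lemma stepFun_apply_of_notMem {h : ℝ → ℝ} {t ξ : ℕ → ℝ} {N : ℕ} (ht : Monotone t)
    {r : ℝ} (hr : r ∉ Ioc (t 0) (t N)) : stepFun h t ξ N r = 0 := by
  rw [stepFun, Finset.sum_apply]
  refine Finset.sum_eq_zero fun k hk => ?_
  have : r ∉ Ioc (t k) (t (k + 1)) := fun h =>
    hr ⟨(ht (Nat.zero_le k)).trans_lt h.1, h.2.trans (ht (Finset.mem_range.1 hk))⟩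
  simp [indicator_of_notMem this]

lemma exists_mem_Ioc_succ {t : ℕ → ℝ} {N : ℕ} {r : ℝ} (hr : r ∈ Ioc (t 0) (t N)) :
    ∃ k < N, r ∈ Ioc (t k) (t (k + 1)) := by
  induction N with
  | zero => exact absurd (hr.1.trans_le hr.2) (lt_irrefl _)
  | succ N ih =>
    rcases le_or_gt r (t N) with h | h
    · obtain ⟨k, hk, hk2⟩ := ih ⟨hr.1, h⟩
      exact ⟨k, hk.trans N.lt_succ_self, hk2⟩
    · exact ⟨N, N.lt_succ_self, h, hr.2⟩

/-- A continuous function is uniformly approximated by its step functions. -/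
theorem exists_forall_abs_stepFun_sub_le {h : ℝ → ℝ} (hh : Continuous h) (a b : ℝ) {η : ℝ}
    (hη : 0 < η) :
    ∃ δ > 0, ∀ (N : ℕ) (t ξ : ℕ → ℝ), Monotone t → t 0 = a → t N = b →
      (∀ k < N, t (k + 1) - t k < δ) → (∀ k < N, ξ k ∈ Icc (t k) (t (k + 1))) →
      ∀ r, |(stepFun h t ξ N - (Ioc a b).indicator h) r| ≤ (Ioc a b).indicator (fun _ => η) r := by
  obtain ⟨δ, hδ, hu⟩ := Metric.uniformContinuousOn_iff.1
    ((isCompact_Icc (a := a) (b := b)).uniformContinuousOn_of_continuous hh.continuousOn) η hη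
  refine ⟨δ, hδ, fun N t ξ ht h0 hN hmesh hξ r => ?_⟩
  rw [Pi.sub_apply]
  by_cases hr : r ∈ Ioc a b
  · rw [indicator_of_mem hr, indicator_of_mem hr]
    obtain ⟨k, hk, hrk⟩ := exists_mem_Ioc_succ (t := t) (N := N) (by rwa [h0, hN])
    rw [stepFun_apply_of_mem ht hk hrk]
    have h1 := hξ k hk
    refine (hu (ξ k) ⟨?_, ?_⟩ r (Ioc_subset_Icc_self hr) ?_).le
    · exact h0 ▸ (ht (Nat.zero_le k)).trans h1.1
    · exact hN ▸ h1.2.trans (ht hk)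
    · have := hmesh k hk
      rw [Real.dist_eq, abs_lt]
      constructor <;> linarith [h1.1, h1.2, hrk.1, hrk.2]
  · rw [indicator_of_notMem hr, indicator_of_notMem hr,
      stepFun_apply_of_notMem ht (by rwa [h0, hN])]
    simp

/-! ### The integral in `L²` and its Riemann sums -/

namespace HasLevyIncrements

variable {Ω : Type*} [MeasurableSpace Ω] {P : Measure Ω} [IsProbabilityMeasure P]
  {Y : ℝ → Ω → ℝ} {Ψ : ℝ → ℂ} {m v : ℝ} {g h : ℝ → ℝ}

open Classical in
/-- The integral `∫_0^∞ g dY` in `L²(P)`. -/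
noncomputable def levyIntegral (hY : HasLevyIncrements Y P Ψ m v) (g : ℝ → ℝ) : Lp ℝ 2 P :=
  if hg : MemLp g 2 volIoi then
    hY.wienerMap hg.toLp + (m * ∫ r, g r ∂volIoi) • Lp.const 2 P (1 : ℝ)
  else 0

lemma levyIntegral_eq (hY : HasLevyIncrements Y P Ψ m v) (hg : MemLp g 2 volIoi) :
    hY.levyIntegral g =
      hY.wienerMap hg.toLp + (m * ∫ r, g r ∂volIoi) • Lp.const 2 P (1 : ℝ) := dif_pos hg

lemma levyIntegral_add (hY : HasLevyIncrements Y P Ψ m v) (hg : IsLevyIntegrand g)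
    (hh : IsLevyIntegrand h) :
    hY.levyIntegral (g + h) = hY.levyIntegral g + hY.levyIntegral h := by
  rw [levyIntegral_eq hY hg.2, levyIntegral_eq hY hh.2, levyIntegral_eq hY (hg.2.add hh.2),
    MemLp.toLp_add hg.2 hh.2, map_add, integral_add' hg.1 hh.1]
  module

lemma levyIntegral_const_smul (hY : HasLevyIncrements Y P Ψ m v) (hg : IsLevyIntegrand g)
    (c : ℝ) : hY.levyIntegral (c • g) = c • hY.levyIntegral g := by
  rw [levyIntegral_eq hY hg.2, levyIntegral_eq hY (hg.2.const_smul c), MemLp.toLp_const_smul c hg.2,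
    map_smul]
  simp only [Pi.smul_apply, smul_eq_mul, integral_const_mul]
  module

lemma levyIntegral_sub (hY : HasLevyIncrements Y P Ψ m v) (hg : IsLevyIntegrand g)
    (hh : IsLevyIntegrand h) :
    hY.levyIntegral (g - h) = hY.levyIntegral g - hY.levyIntegral h := by
  have := hY.levyIntegral_add (hg.sub hh) hh
  rw [sub_add_cancel] at this
  rw [this, add_sub_cancel_right]

lemma levyIntegral_sum (hY : HasLevyIncrements Y P Ψ m v) {ι : Type*} (s : Finset ι)
    {g : ι → ℝ → ℝ} (hg : ∀ i ∈ s, IsLevyIntegrand (g i)) :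
    hY.levyIntegral (∑ i ∈ s, g i) = ∑ i ∈ s, hY.levyIntegral (g i) := by
  classical
  induction s using Finset.induction_on with
  | empty =>
    have := hY.levyIntegral_const_smul IsLevyIntegrand.zero 0
    simpa using this
  | insert a s ha ih =>
    have h1 : ∀ i ∈ s, IsLevyIntegrand (g i) := fun i hi => hg i (Finset.mem_insert_of_mem hi)
    rw [Finset.sum_insert ha, Finset.sum_insert ha,
      hY.levyIntegral_add (hg a (Finset.mem_insert_self _ _)) (IsLevyIntegrand.sum s h1), ih h1]

/-- Cross terms vanish because the Wiener part is orthogonal to constants; this identity is the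
source of all the moment formulas. -/
lemma inner_levyIntegral (hY : HasLevyIncrements Y P Ψ m v) (hg : MemLp g 2 volIoi)
    (hh : MemLp h 2 volIoi) :
    inner ℝ (hY.levyIntegral g) (hY.levyIntegral h)
      = v * ∫ r, g r * h r ∂volIoi + m ^ 2 * (∫ r, g r ∂volIoi) * ∫ r, h r ∂volIoi := by
  have h1 : inner ℝ hg.toLp hh.toLp = ∫ r, g r * h r ∂volIoi := by
    rw [L2.inner_def]
    refine integral_congr_ae ?_
    filter_upwards [hg.coeFn_toLp, hh.coeFn_toLp] with r h1 h2
    simp [h1, h2, mul_comm]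
  have h2 : inner ℝ (Lp.const 2 P (1 : ℝ)) (Lp.const 2 P (1 : ℝ)) = (1 : ℝ) := by
    rw [← indicatorConstLp_univ, L2.real_inner_indicatorConstLp_one_indicatorConstLp_one]
    simp
  rw [levyIntegral_eq hY hg, levyIntegral_eq hY hh, inner_add_left, inner_add_right,
    inner_add_right, hY.inner_wienerMap, real_inner_smul_right, hY.inner_wienerMap_const,
    real_inner_smul_left, real_inner_comm (hY.wienerMap hh.toLp), hY.inner_wienerMap_const,
    real_inner_smul_left, real_inner_smul_right, h1, h2]
  ring

lemma integral_levyIntegral (hY : HasLevyIncrements Y P Ψ m v) (hg : MemLp g 2 volIoi) :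
    ∫ ω, hY.levyIntegral g ω ∂P = m * ∫ r, g r ∂volIoi := by
  have h1 : ∫ ω, hY.levyIntegral g ω ∂P
      = inner ℝ (Lp.const 2 P (1 : ℝ)) (hY.levyIntegral g) := by
    rw [← indicatorConstLp_univ, L2.inner_indicatorConstLp_one, Measure.restrict_univ]
  have h2 : inner ℝ (Lp.const 2 P (1 : ℝ)) (Lp.const 2 P (1 : ℝ)) = (1 : ℝ) := by
    rw [← indicatorConstLp_univ, L2.real_inner_indicatorConstLp_one_indicatorConstLp_one]
    simp
  rw [h1, levyIntegral_eq hY hg, inner_add_right, real_inner_comm, hY.inner_wienerMap_const,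
    real_inner_smul_right, h2]
  ring

lemma integral_levyIntegral_mul (hY : HasLevyIncrements Y P Ψ m v) (hg : MemLp g 2 volIoi)
    (hh : MemLp h 2 volIoi) :
    ∫ ω, hY.levyIntegral g ω * hY.levyIntegral h ω ∂P
      = v * ∫ r, g r * h r ∂volIoi + m ^ 2 * (∫ r, g r ∂volIoi) * ∫ r, h r ∂volIoi := by
  rw [← hY.inner_levyIntegral hg hh, L2.inner_def]
  simp [mul_comm]

/-- The isometry with drift: `L²` errors of integrals reduce to the `L²` norm and the mean of the
error in the integrand. -/
lemma norm_sq_levyIntegral (hY : HasLevyIncrements Y P Ψ m v) (hg : MemLp g 2 volIoi) :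
    ‖hY.levyIntegral g‖ ^ 2 = v * ∫ r, g r ^ 2 ∂volIoi + (m * ∫ r, g r ∂volIoi) ^ 2 := by
  rw [← real_inner_self_eq_norm_sq, hY.inner_levyIntegral hg hg]
  simp only [← pow_two]
  ring

lemma levyIntegral_indicator_zero (hY : HasLevyIncrements Y P Ψ m v) (t : ℝ≥0) :
    hY.levyIntegral ((Ioc (0 : ℝ) t).indicator 1)
      = (hY.memLp_sub 0 t le_rfl t.coe_nonneg).toLp := by
  have h1 := (IsLevyIntegrand.indicator_Ioc (g := 1) continuous_const 0 t).memLp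
  have h2 : h1.toLp = indicatorIoc t := rfl
  have h3 : ∫ r, (Ioc (0 : ℝ) t).indicator (1 : ℝ → ℝ) r ∂volIoi = t := by
    rw [integral_indicator_one measurableSet_Ioc,
      measureReal_restrict_apply measurableSet_Ioc, inter_eq_left.2 fun x hx => hx.1,
      Real.volume_real_Ioc_of_le t.coe_nonneg, sub_zero]
  rw [levyIntegral_eq hY h1, h2, h3, wienerMap_indicatorIoc]
  ext1
  filter_upwards [Lp.coeFn_add (hY.centeredLp t) ((m * (t : ℝ)) • Lp.const 2 P (1 : ℝ)),
    Lp.coeFn_smul (m * (t : ℝ)) (Lp.const 2 P (1 : ℝ)), Lp.coeFn_const (p := 2) (μ := P) (1 : ℝ),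
    (hY.memLp_centered le_rfl t.coe_nonneg).coeFn_toLp,
    (hY.memLp_sub 0 t le_rfl t.coe_nonneg).coeFn_toLp] with ω e1 e2 e3 e4 e5
  rw [e1, e5, Pi.add_apply, e2, Pi.smul_apply, e3, centeredLp, e4]
  simp
  ring

lemma levyIntegral_indicator (hY : HasLevyIncrements Y P Ψ m v) {a b : ℝ} (ha : 0 ≤ a)
    (hab : a ≤ b) :
    hY.levyIntegral ((Ioc a b).indicator 1) = (hY.memLp_sub a b ha hab).toLp := by
  have h1 : (Ioc a b).indicator (1 : ℝ → ℝ)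
      = (Ioc 0 b).indicator 1 - (Ioc 0 a).indicator 1 := by
    rw [← Ioc_union_Ioc_eq_Ioc ha hab, indicator_union_of_disjoint]
    · ext r
      simp
    · exact Ioc_disjoint_Ioc_of_le le_rfl
  have h2 : hY.levyIntegral ((Ioc 0 a).indicator 1)
      = (hY.memLp_sub 0 a le_rfl ha).toLp := hY.levyIntegral_indicator_zero ⟨a, ha⟩
  have h3 : hY.levyIntegral ((Ioc 0 b).indicator 1)
      = (hY.memLp_sub 0 b le_rfl (ha.trans hab)).toLp :=
    hY.levyIntegral_indicator_zero ⟨b, ha.trans hab⟩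
  rw [h1, hY.levyIntegral_sub (IsLevyIntegrand.indicator_Ioc (g := 1) continuous_const _ _)
    (IsLevyIntegrand.indicator_Ioc (g := 1) continuous_const _ _), h2, h3, ← MemLp.toLp_sub]
  refine MemLp.toLp_congr _ _ (Eventually.of_forall fun ω => ?_)
  simp

lemma levyIntegral_stepFun (hY : HasLevyIncrements Y P Ψ m v) (h : ℝ → ℝ) {t : ℕ → ℝ} (ξ : ℕ → ℝ)
    (N : ℕ) (ht : Monotone t) (h0 : 0 ≤ t 0) :
    hY.levyIntegral (stepFun h t ξ N) =ᵐ[P]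
      fun ω => ∑ k ∈ Finset.range N, h (ξ k) * (Y (t (k + 1)) ω - Y (t k) ω) := by
  have hi : ∀ k, IsLevyIntegrand ((Ioc (t k) (t (k + 1))).indicator (1 : ℝ → ℝ)) := fun k =>
    IsLevyIntegrand.indicator_Ioc continuous_const _ _
  have ht0 : ∀ k, 0 ≤ t k := fun k => h0.trans (ht k.zero_le)
  rw [stepFun, hY.levyIntegral_sum _ fun k _ => (hi k).const_smul _]
  have h1 : ∀ k, hY.levyIntegral (h (ξ k) • (Ioc (t k) (t (k + 1))).indicator (1 : ℝ → ℝ))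
      =ᵐ[P] fun ω => h (ξ k) * (Y (t (k + 1)) ω - Y (t k) ω) := by
    intro k
    rw [hY.levyIntegral_const_smul (hi k), hY.levyIntegral_indicator (ht0 k) (ht k.le_succ)]
    filter_upwards [Lp.coeFn_smul (h (ξ k))
      (hY.memLp_sub (t k) (t (k + 1)) (ht0 k) (ht k.le_succ)).toLp,
      (hY.memLp_sub (t k) (t (k + 1)) (ht0 k) (ht k.le_succ)).coeFn_toLp] with ω e1 e2
    rw [e1, Pi.smul_apply, e2, smul_eq_mul]
  filter_upwards [Lp.coeFn_finsetSum (Finset.range N) fun k =>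
    hY.levyIntegral (h (ξ k) • (Ioc (t k) (t (k + 1))).indicator (1 : ℝ → ℝ)),
    ae_all_iff.2 h1] with ω e1 e2
  rw [e1, Finset.sum_apply]
  exact Finset.sum_congr rfl fun k _ => e2 k

/-- Riemann sums of a continuous function converge to the integral in `L²`. -/
theorem exists_forall_norm_levyIntegral_stepFun_sub_le (hY : HasLevyIncrements Y P Ψ m v)
    (hh : Continuous h) {T : ℝ} (hT : 0 ≤ T) {ε : ℝ} (hε : 0 < ε) :
    ∃ δ > 0, ∀ (N : ℕ) (t ξ : ℕ → ℝ), Monotone t → t 0 = 0 → t N = T →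
      (∀ k < N, t (k + 1) - t k < δ) → (∀ k < N, ξ k ∈ Icc (t k) (t (k + 1))) →
      ‖hY.levyIntegral (stepFun h t ξ N) - hY.levyIntegral ((Ioc 0 T).indicator h)‖ ≤ ε := by
  have hv := hY.variance_nonneg
  -- An integrand bounded by `η` on `(0, T]` and zero elsewhere has an integral of squared norm at
  -- most `(v T + (m T)²) η²`, so `η = ε / √K` suffices; the summand 1 keeps `K` positive.
  set K : ℝ := v * T + (m * T) ^ 2 + 1 with hK
  have hK0 : 0 < K := by positivity
  obtain ⟨δ, hδ, hδ2⟩ := exists_forall_abs_stepFun_sub_le hh 0 T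
    (div_pos hε (Real.sqrt_pos.2 hK0))
  refine ⟨δ, hδ, fun N t ξ ht h0 hN hmesh hξ => ?_⟩
  have hD := hδ2 N t ξ ht h0 hN hmesh hξ
  set η := ε / √K with hη
  have hη0 : 0 < η := div_pos hε (Real.sqrt_pos.2 hK0)
  have i1 := isLevyIntegrand_stepFun h t ξ N
  have i2 := IsLevyIntegrand.indicator_Ioc hh 0 T
  rw [← hY.levyIntegral_sub i1 i2]
  set D := stepFun h t ξ N - (Ioc 0 T).indicator h with hDdef
  have i3 : IsLevyIntegrand D := i1.sub i2
  have hvol : ∀ c : ℝ, ∫ r, (Ioc 0 T).indicator (fun _ => c) r ∂volIoi = T * c := by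
    intro c
    rw [integral_indicator_const _ measurableSet_Ioc, measureReal_restrict_apply measurableSet_Ioc,
      inter_eq_left.2 fun x hx => hx.1, Real.volume_real_Ioc_of_le hT, sub_zero, smul_eq_mul]
  have hci : ∀ c : ℝ, Integrable ((Ioc 0 T).indicator (fun _ => c)) volIoi := fun c =>
    (IsLevyIntegrand.indicator_Ioc continuous_const 0 T).integrable
  have b1 : |∫ r, D r ∂volIoi| ≤ T * η := by
    rw [← hvol]
    exact norm_integral_le_of_norm_le (f := D) (hci η) (Eventually.of_forall hD)
  have b2 : ∫ r, D r ^ 2 ∂volIoi ≤ T * η ^ 2 := by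
    rw [← hvol]
    refine integral_mono i3.memLp.integrable_sq (hci _) fun r => ?_
    have := hD r
    by_cases hr : r ∈ Ioc 0 T
    · rw [indicator_of_mem hr] at this ⊢
      exact sq_le_sq' (neg_le_of_abs_le this) (le_of_abs_le this)
    · rw [indicator_of_notMem hr] at this ⊢
      simp [abs_nonpos_iff.1 this]
  refine le_of_sq_le_sq ?_ hε.le
  have b3 : (m * ∫ r, D r ∂volIoi) ^ 2 ≤ (m * (T * η)) ^ 2 := by
    rw [mul_pow, mul_pow]
    refine mul_le_mul_of_nonneg_left ?_ (sq_nonneg _)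
    exact sq_le_sq' (neg_le_of_abs_le b1) (le_of_abs_le b1)
  have hεK : ε ^ 2 = K * η ^ 2 := by
    rw [hη, div_pow, Real.sq_sqrt hK0.le]
    field_simp
  rw [hY.norm_sq_levyIntegral i3.memLp, hεK]
  calc _ ≤ v * (T * η ^ 2) + (m * (T * η)) ^ 2 := by gcongr
    _ ≤ K * η ^ 2 := by
      rw [hK]
      nlinarith [sq_nonneg η]

end HasLevyIncrements

/-! ### Laws of the integrals and time reversal -/

/-- Random vectors with equal characteristic functions have the same law. -/
theorem map_pi_eq_of_forall_charFun_sum_eq {Ω Ω' ι : Type*} [MeasurableSpace Ω]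
    [MeasurableSpace Ω'] {P : Measure Ω} [IsProbabilityMeasure P] {P' : Measure Ω'}
    [IsProbabilityMeasure P'] [Fintype ι] {X : ι → Ω → ℝ} {X' : ι → Ω' → ℝ}
    (hX : ∀ i, AEMeasurable (X i) P) (hX' : ∀ i, AEMeasurable (X' i) P')
    (h : ∀ c : ι → ℝ, charFun (P.map fun ω => ∑ i, c i * X i ω) 1
      = charFun (P'.map fun ω => ∑ i, c i * X' i ω) 1) :
    P.map (fun ω i => X i ω) = P'.map (fun ω i => X' i ω) := by
  classical
  have hm : AEMeasurable (fun ω i => X i ω) P := aemeasurable_pi_lambda _ hX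
  have hm' : AEMeasurable (fun ω i => X' i ω) P' := aemeasurable_pi_lambda _ hX'
  have := Measure.isProbabilityMeasure_map hm
  have := Measure.isProbabilityMeasure_map hm'
  refine Measure.ext_of_charFunDual (funext fun ℓ => ?_)
  have hℓ : ∀ x : ι → ℝ, ℓ x = ∑ i, ℓ (Pi.single i 1) * x i := by
    intro x
    conv_lhs => rw [pi_eq_sum_univ' x, map_sum]
    refine Finset.sum_congr rfl fun i _ => ?_
    rw [map_smul, smul_eq_mul, mul_comm]
  rw [charFunDual_eq_charFun_map_one, charFunDual_eq_charFun_map_one,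
    AEMeasurable.map_map_of_aemeasurable (by fun_prop) hm,
    AEMeasurable.map_map_of_aemeasurable (by fun_prop) hm']
  simp only [Function.comp_def]
  rw [funext fun ω => hℓ fun i => X i ω, funext fun ω => hℓ fun i => X' i ω]
  exact h fun i => ℓ (Pi.single i 1)

namespace HasLevyIncrements

variable {Ω Ω' : Type*} [MeasurableSpace Ω] [MeasurableSpace Ω'] {P : Measure Ω}
  {P' : Measure Ω'} {Y : ℝ → Ω → ℝ} {Y' : ℝ → Ω' → ℝ} {Ψ : ℝ → ℂ} {m v m' v' : ℝ} {g h : ℝ → ℝ}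

/-- Independence turns the sum into a product of exponentials. The right side involves the process
only through `Ψ`. -/
lemma charFun_riemannSum (hY : HasLevyIncrements Y P Ψ m v) (h : ℝ → ℝ) {t : ℕ → ℝ} (ξ : ℕ → ℝ)
    (N : ℕ) (ht : Monotone t) (h0 : 0 ≤ t 0) (lam : ℝ) :
    charFun (P.map fun ω => ∑ k ∈ Finset.range N, h (ξ k) * (Y (t (k + 1)) ω - Y (t k) ω)) lam
      = Complex.exp (∑ k ∈ Finset.range N, ((t (k + 1) - t k : ℝ) : ℂ) * Ψ (h (ξ k) * lam)) := by
  have hm : ∀ k, Measurable fun ω => Y (t (k + 1)) ω - Y (t k) ω := fun k =>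
    (hY.measurable _).sub (hY.measurable _)
  have hi : iIndepFun (fun k ω => h (ξ k) * (Y (t (k + 1)) ω - Y (t k) ω)) P :=
    (hY.indep t ht h0).comp (fun k x => h (ξ k) * x) fun k => measurable_const_mul _
  rw [iIndepFun.charFun_map_fun_finsetSum_eq_prod (fun k _ => ((hm k).const_mul _).aemeasurable)
    (hi.restrict _), Finset.prod_apply, Complex.exp_sum]
  refine Finset.prod_congr rfl fun k _ => ?_
  rw [charFun_map_mul_comp (hm k).aemeasurable,
    hY.charFun_sub _ _ (h0.trans (ht k.zero_le)) (ht k.le_succ)]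

variable [IsProbabilityMeasure P] [IsProbabilityMeasure P']

lemma aemeasurable_levyIntegral (hY : HasLevyIncrements Y P Ψ m v) (g : ℝ → ℝ) :
    AEMeasurable (hY.levyIntegral g) P := (Lp.stronglyMeasurable _).measurable.aemeasurable

theorem isStochIntegral_levyIntegral (hY : HasLevyIncrements Y P Ψ m v) (hh : Continuous h)
    {T : ℝ} (hT : 0 ≤ T) :
    IsStochIntegral P Y h 0 T (hY.levyIntegral ((Ioc 0 T).indicator h)) := by
  refine ⟨hY.aemeasurable_levyIntegral _, fun ε hε => ?_⟩
  -- With an `L²` error of at most `ε √ε`, Chebyshev's inequality at level `ε` gives probability at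
  -- most `(ε √ε)² / ε² = ε`.
  obtain ⟨δ, hδ, H⟩ := hY.exists_forall_norm_levyIntegral_stepFun_sub_le hh hT
    (mul_pos hε (Real.sqrt_pos.2 hε))
  refine ⟨δ, hδ, fun N t ξ ht h0 hN hmesh hξ => ?_⟩
  have h1 := H N t ξ ht h0 hN hmesh hξ
  set D : Lp ℝ 2 P := hY.levyIntegral (stepFun h t ξ N)
    - hY.levyIntegral ((Ioc 0 T).indicator h) with hD
  have h2 : (fun ω => ∑ k ∈ Finset.range N, h (ξ k) * (Y (t (k + 1)) ω - Y (t k) ω)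
      - hY.levyIntegral ((Ioc 0 T).indicator h) ω) =ᵐ[P] D := by
    filter_upwards [hY.levyIntegral_stepFun h ξ N ht h0.ge,
      Lp.coeFn_sub (hY.levyIntegral (stepFun h t ξ N))
        (hY.levyIntegral ((Ioc 0 T).indicator h))] with ω e1 e2
    rw [hD, e2, Pi.sub_apply, e1]
  have h3 : P {ω | ε ≤ |∑ k ∈ Finset.range N, h (ξ k) * (Y (t (k + 1)) ω - Y (t k) ω)
      - hY.levyIntegral ((Ioc 0 T).indicator h) ω|} = P {ω | ENNReal.ofReal ε ≤ ‖D ω‖ₑ} := by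
    refine measure_congr (eventuallyEq_set.2 ?_)
    filter_upwards [h2] with ω hω
    rw [← hω, Real.enorm_eq_ofReal_abs, ENNReal.ofReal_le_ofReal_iff (abs_nonneg _)]
  have hε0 : ENNReal.ofReal ε ≠ 0 := (ENNReal.ofReal_pos.2 hε).ne'
  have h4 := meas_ge_le_mul_pow_eLpNorm_enorm P (p := 2) (by norm_num) (by norm_num)
    (Lp.aestronglyMeasurable D) hε0 (fun h => absurd h ENNReal.ofReal_ne_top)
  rw [h3]
  refine h4.trans ?_
  have h5 : eLpNorm D 2 P ≤ ENNReal.ofReal (ε * √ε) := by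
    rw [← ENNReal.ofReal_toReal (Lp.eLpNorm_ne_top D), ← Lp.norm_def]
    exact ENNReal.ofReal_le_ofReal h1
  calc _ ≤ (ENNReal.ofReal ε)⁻¹ ^ (2 : ENNReal).toReal
        * ENNReal.ofReal (ε * √ε) ^ (2 : ENNReal).toReal := by gcongr
    _ = ENNReal.ofReal ε := by
      rw [← ENNReal.ofReal_inv_of_pos hε,
        ENNReal.ofReal_rpow_of_nonneg (by positivity) (by norm_num),
        ENNReal.ofReal_rpow_of_nonneg (by positivity) (by norm_num),
        ← ENNReal.ofReal_mul (by positivity)]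
      congr 1
      simp only [ENNReal.toReal_ofNat, Real.rpow_ofNat]
      rw [mul_pow, Real.sq_sqrt hε.le]
      field_simp

/-- The characteristic function of the integral over `[0, T]` is the limit of those of the Riemann
sums over uniform partitions. -/
theorem tendsto_charFun_levyIntegral (hY : HasLevyIncrements Y P Ψ m v) (hh : Continuous h)
    {T : ℝ} (hT : 0 ≤ T) (ξ : ℕ → ℕ → ℝ)
    (hξ : ∀ N k : ℕ, k < N + 1 → ξ N k ∈
      Icc ((k : ℝ) * (T / (N + 1 : ℕ))) (((k + 1 : ℕ) : ℝ) * (T / (N + 1 : ℕ)))) (lam : ℝ) :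
    Tendsto (fun N : ℕ => Complex.exp (∑ k ∈ Finset.range (N + 1),
      ((T / (N + 1 : ℕ) : ℝ) : ℂ) * Ψ (h (ξ N k) * lam))) atTop
      (𝓝 (charFun (P.map (hY.levyIntegral ((Ioc 0 T).indicator h))) lam)) := by
  set t : ℕ → ℕ → ℝ := fun N k => k * (T / (N + 1 : ℕ)) with ht
  have hmono : ∀ N, Monotone (t N) := fun N i j hij => by
    simp only [ht]
    gcongr
  have h0 : ∀ N, t N 0 = 0 := fun N => by simp [ht]
  have hN : ∀ N, t N (N + 1) = T := fun N => by
    simp only [ht]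
    field_simp
  have hd : ∀ N k, t N (k + 1) - t N k = T / (N + 1 : ℕ) := fun N k => by
    simp only [ht]
    push_cast
    ring
  have hlim : Tendsto (fun N => hY.levyIntegral (stepFun h (t N) (ξ N) (N + 1))) atTop
      (𝓝 (hY.levyIntegral ((Ioc 0 T).indicator h))) := by
    refine Metric.tendsto_atTop.2 fun ε hε => ?_
    obtain ⟨δ, hδ, H⟩ := hY.exists_forall_norm_levyIntegral_stepFun_sub_le hh hT (half_pos hε)
    have hmesh : Tendsto (fun N : ℕ => T / ((N + 1 : ℕ) : ℝ)) atTop (𝓝 0) :=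
      (tendsto_const_div_atTop_nhds_zero_nat T).comp (tendsto_add_atTop_nat 1)
    obtain ⟨N₀, hN₀⟩ := eventually_atTop.1 (hmesh.eventually_lt_const hδ)
    refine ⟨N₀, fun N hNN => ?_⟩
    rw [dist_eq_norm]
    refine (H (N + 1) (t N) (ξ N) (hmono N) (h0 N) (hN N) (fun k _ => ?_) (hξ N)).trans_lt
      (half_lt_self hε)
    rw [hd]
    exact hN₀ N hNN
  have := tendsto_charFun_of_tendstoInMeasure (tendstoInMeasure_of_tendsto_Lp hlim)
    (fun N => hY.aemeasurable_levyIntegral _) (hY.aemeasurable_levyIntegral _) lam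
  refine this.congr fun N => ?_
  rw [Measure.map_congr (hY.levyIntegral_stepFun h (ξ N) (N + 1) (hmono N) (h0 N).ge),
    hY.charFun_riemannSum h (ξ N) (N + 1) (hmono N) (h0 N).ge]
  simp only [hd]

theorem charFun_levyIntegral_indicator_eq (hY : HasLevyIncrements Y P Ψ m v)
    (hY' : HasLevyIncrements Y' P' Ψ m' v') (hh : Continuous h) {T : ℝ} (hT : 0 ≤ T) (lam : ℝ) :
    charFun (P.map (hY.levyIntegral ((Ioc 0 T).indicator h))) lam
      = charFun (P'.map (hY'.levyIntegral ((Ioc 0 T).indicator h))) lam := by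
  have hξ : ∀ N k : ℕ, k < N + 1 → (k : ℝ) * (T / (N + 1 : ℕ)) ∈
      Icc ((k : ℝ) * (T / (N + 1 : ℕ))) (((k + 1 : ℕ) : ℝ) * (T / (N + 1 : ℕ))) :=
    fun N k _ => ⟨le_rfl, by gcongr; simp⟩
  exact tendsto_nhds_unique (hY.tendsto_charFun_levyIntegral hh hT _ hξ lam)
    (hY'.tendsto_charFun_levyIntegral hh hT _ hξ lam)

/-- The law of the integral over `[0, T]` is invariant under time reversal of the integrand. -/
theorem charFun_levyIntegral_indicator_reverse (hY : HasLevyIncrements Y P Ψ m v)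
    (hh : Continuous h) {T : ℝ} (hT : 0 ≤ T) (lam : ℝ) :
    charFun (P.map (hY.levyIntegral ((Ioc 0 T).indicator fun r => h (T - r)))) lam
      = charFun (P.map (hY.levyIntegral ((Ioc 0 T).indicator h))) lam := by
  -- Right endpoints for the reversed integrand become left endpoints for `h` under `k ↦ N - k`, so
  -- both sequences of exponents coincide.
  have h1 := hY.tendsto_charFun_levyIntegral (h := fun r => h (T - r)) (by fun_prop) hT
    (fun N k => ((k + 1 : ℕ) : ℝ) * (T / (N + 1 : ℕ)))
    (fun N k _ => ⟨by gcongr; simp, le_rfl⟩) lam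
  have h2 := hY.tendsto_charFun_levyIntegral hh hT (fun N k => (k : ℝ) * (T / (N + 1 : ℕ)))
    (fun N k _ => ⟨le_rfl, by gcongr; simp⟩) lam
  refine tendsto_nhds_unique h1 (h2.congr fun N => ?_)
  rw [← Finset.sum_range_reflect]
  congr 1
  refine Finset.sum_congr rfl fun k hk => ?_
  have hk' : k ≤ N := Nat.lt_succ_iff.1 (Finset.mem_range.1 hk)
  congr 4
  rw [Nat.add_sub_cancel, Nat.cast_sub hk']
  push_cast
  field_simp
  ring

lemma tendsto_integral_sub_indicator {f : ℝ → ℝ} (hf : Integrable f volIoi) :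
    Tendsto (fun T => ∫ r, (f - (Ioc 0 T).indicator f) r ∂volIoi) atTop (𝓝 0) := by
  have h1 := intervalIntegral_tendsto_integral_Ioi 0 hf tendsto_id
  have h2 := h1.const_sub (∫ r, f r ∂volIoi)
  rw [sub_self] at h2
  refine h2.congr' ?_
  filter_upwards [eventually_ge_atTop 0] with T hT
  rw [integral_sub' hf (hf.indicator measurableSet_Ioc), integral_indicator measurableSet_Ioc,
    volIoi_restrict_Ioc le_rfl, id, intervalIntegral.integral_of_le hT]

/-- The squared error is `v ∫_T^∞ g² + (m ∫_T^∞ g)²`, and both tails tend to zero. -/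
theorem tendsto_levyIntegral_indicator (hY : HasLevyIncrements Y P Ψ m v)
    (hg : IsLevyIntegrand g) (hc : Continuous g) :
    Tendsto (fun T => hY.levyIntegral ((Ioc 0 T).indicator g)) atTop
      (𝓝 (hY.levyIntegral g)) := by
  have hsq : ∀ T, (fun r => (g - (Ioc 0 T).indicator g) r ^ 2)
      = fun r => ((fun r => g r ^ 2) - (Ioc 0 T).indicator fun r => g r ^ 2) r := by
    intro T
    funext r
    by_cases hr : r ∈ Ioc 0 T
    · simp [indicator_of_mem hr]
    · simp [indicator_of_notMem hr]
  have h1 := ((tendsto_integral_sub_indicator hg.memLp.integrable_sq).const_mul v).add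
    (((tendsto_integral_sub_indicator hg.integrable).const_mul m).pow 2)
  have h2 := (Real.continuous_sqrt.tendsto _).comp h1
  rw [tendsto_iff_norm_sub_tendsto_zero]
  simp only [mul_zero, ne_eq, OfNat.ofNat_ne_zero, not_false_eq_true, zero_pow, add_zero,
    Real.sqrt_zero] at h2
  refine h2.congr fun T => ?_
  have hi := IsLevyIntegrand.indicator_Ioc hc 0 T
  rw [norm_sub_rev, ← hY.levyIntegral_sub hg hi, ← Real.sqrt_sq (norm_nonneg _),
    hY.norm_sq_levyIntegral (hg.sub hi).memLp, hsq]
  rfl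

theorem charFun_levyIntegral_eq (hY : HasLevyIncrements Y P Ψ m v)
    (hY' : HasLevyIncrements Y' P' Ψ m' v') (hg : IsLevyIntegrand g) (hc : Continuous g)
    (lam : ℝ) :
    charFun (P.map (hY.levyIntegral g)) lam = charFun (P'.map (hY'.levyIntegral g)) lam := by
  have h1 := tendsto_charFun_of_tendstoInMeasure
    (tendstoInMeasure_of_tendsto_Lp (hY.tendsto_levyIntegral_indicator hg hc))
    (fun N => hY.aemeasurable_levyIntegral _) (hY.aemeasurable_levyIntegral _) lam
  have h2 := tendsto_charFun_of_tendstoInMeasure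
    (tendstoInMeasure_of_tendsto_Lp (hY'.tendsto_levyIntegral_indicator hg hc))
    (fun N => hY'.aemeasurable_levyIntegral _) (hY'.aemeasurable_levyIntegral _) lam
  refine tendsto_nhds_unique h1 (h2.congr' ?_)
  filter_upwards [eventually_ge_atTop 0] with T hT
  exact (hY.charFun_levyIntegral_indicator_eq hY' hc hT lam).symm

lemma levyIntegral_sum_smul (hY : HasLevyIncrements Y P Ψ m v) {ι : Type*} [Fintype ι]
    {g : ι → ℝ → ℝ} (hg : ∀ i, IsLevyIntegrand (g i)) (c : ι → ℝ) :
    (fun ω => ∑ i, c i * hY.levyIntegral (g i) ω) =ᵐ[P]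
      hY.levyIntegral (∑ i, c i • g i) := by
  rw [hY.levyIntegral_sum _ fun i _ => (hg i).const_smul _]
  filter_upwards [Lp.coeFn_finsetSum Finset.univ fun i => hY.levyIntegral (c i • g i),
    ae_all_iff.2 fun i => Lp.coeFn_smul (c i) (hY.levyIntegral (g i))] with ω e1 e2
  rw [e1, Finset.sum_apply]
  refine Finset.sum_congr rfl fun i _ => ?_
  rw [hY.levyIntegral_const_smul (hg i), e2, Pi.smul_apply, smul_eq_mul]

lemma map_levyIntegral_pi_eq (hY : HasLevyIncrements Y P Ψ m v)
    (hY' : HasLevyIncrements Y' P' Ψ m' v') {ι : Type*} [Fintype ι]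
    {g g' : ι → ℝ → ℝ} (hg : ∀ i, IsLevyIntegrand (g i)) (hg' : ∀ i, IsLevyIntegrand (g' i))
    (h : ∀ c : ι → ℝ, charFun (P.map (hY.levyIntegral (∑ i, c i • g i))) 1
      = charFun (P'.map (hY'.levyIntegral (∑ i, c i • g' i))) 1) :
    P.map (fun ω i => hY.levyIntegral (g i) ω) = P'.map (fun ω i => hY'.levyIntegral (g' i) ω) := by
  refine map_pi_eq_of_forall_charFun_sum_eq (fun i => hY.aemeasurable_levyIntegral _)
    (fun i => hY'.aemeasurable_levyIntegral _) fun c => ?_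
  rw [Measure.map_congr (hY.levyIntegral_sum_smul hg c),
    Measure.map_congr (hY'.levyIntegral_sum_smul hg' c), h c]

lemma sum_smul_indicator {ι : Type*} [Fintype ι] (g : ι → ℝ → ℝ) (c : ι → ℝ) (s : Set ℝ) :
    ∑ i, c i • s.indicator (g i) = s.indicator (∑ i, c i • g i) := by
  funext r
  by_cases hr : r ∈ s
  · simp [indicator_of_mem hr]
  · simp [indicator_of_notMem hr]

lemma continuous_sum_smul {ι : Type*} [Fintype ι] {g : ι → ℝ → ℝ} (hg : ∀ i, Continuous (g i))
    (c : ι → ℝ) : Continuous (∑ i, c i • g i) := by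
  rw [Finset.sum_fn]
  exact continuous_finsetSum _ fun i _ => (hg i).const_smul (c i)

/-- Joint time reversal invariance of integrals over `[0, T]`. -/
theorem map_levyIntegral_indicator_reverse (hY : HasLevyIncrements Y P Ψ m v) {ι : Type*}
    [Fintype ι] {g : ι → ℝ → ℝ} (hg : ∀ i, Continuous (g i)) {T : ℝ} (hT : 0 ≤ T) :
    P.map (fun ω i => hY.levyIntegral ((Ioc 0 T).indicator fun r => g i (T - r)) ω)
      = P.map (fun ω i => hY.levyIntegral ((Ioc 0 T).indicator (g i)) ω) := by
  refine hY.map_levyIntegral_pi_eq hY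
    (fun i => IsLevyIntegrand.indicator_Ioc ((hg i).comp (by fun_prop)) _ _)
    (fun i => IsLevyIntegrand.indicator_Ioc (hg i) _ _) fun c => ?_
  have hr : (∑ i, c i • fun r => g i (T - r)) = fun r => (∑ i, c i • g i) (T - r) := by
    funext r
    simp
  rw [sum_smul_indicator, sum_smul_indicator, hr, hY.charFun_levyIntegral_indicator_reverse
    (continuous_sum_smul hg c) hT]

/-- The joint law of integrals over `[0, ∞)` is determined by the cumulant. -/
theorem map_levyIntegral_eq (hY : HasLevyIncrements Y P Ψ m v)
    (hY' : HasLevyIncrements Y' P' Ψ m' v') {ι : Type*} [Fintype ι] {g : ι → ℝ → ℝ}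
    (hg : ∀ i, IsLevyIntegrand (g i)) (hc : ∀ i, Continuous (g i)) :
    P.map (fun ω i => hY.levyIntegral (g i) ω) = P'.map (fun ω i => hY'.levyIntegral (g i) ω) :=
  hY.map_levyIntegral_pi_eq hY' hg hg fun c => hY.charFun_levyIntegral_eq hY'
    (IsLevyIntegrand.sum _ fun i _ => (hg i).const_smul _)
    (continuous_sum_smul hc c) 1

end HasLevyIncrements

/-! ### From Lévy processes to `HasLevyIncrements` -/

lemma ProbabilityTheory.HasIndepIncrements.neg_comp_neg {Ω : Type*} [MeasurableSpace Ω]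
    {P : Measure Ω} {M : ℝ → Ω → ℝ} (hM : HasIndepIncrements M P) :
    HasIndepIncrements (fun u ω => -M (-u) ω) P := by
  intro n t ht
  have h1 := (hM n (fun j => -t (Fin.rev j)) fun i j hij =>
    neg_le_neg (ht (Fin.rev_le_rev.2 hij))).precomp Fin.rev_injective
  simp only [Fin.rev_succ, Fin.rev_castSucc, Fin.rev_rev] at h1
  convert h1 using 3
  ring

section Construction

variable {Ω : Type*} [MeasurableSpace Ω] {P : Measure Ω} [IsProbabilityMeasure P]
  {Ψ : ℝ → ℂ} {m v : ℝ}

lemma memLp_two_of_charFun_eq_cexp {X : Ω → ℝ} (hX : AEMeasurable X P) (hΨ : ContDiff ℝ 2 Ψ)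
    {t : ℝ} (h : ∀ lam, charFun (P.map X) lam = Complex.exp (t * Ψ lam)) : MemLp X 2 P := by
  have := Measure.isProbabilityMeasure_map hX
  have h1 : MemLp id 2 (P.map X) := by
    refine memLp_id_two_of_contDiff_charFun ?_
    rw [funext h]
    exact (contDiff_const.mul hΨ).cexp
  exact (memLp_map_measure_iff (by fun_prop) hX).1 h1

lemma integral_eq_of_charFun_eq_cexp {X : Ω → ℝ} (hX : AEMeasurable X P) (hΨ : ContDiff ℝ 2 Ψ)
    (hm : (m : ℂ) = -Complex.I * deriv Ψ 0) {t : ℝ}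
    (h : ∀ lam, charFun (P.map X) lam = Complex.exp (t * Ψ lam)) : ∫ ω, X ω ∂P = t * m := by
  have := Measure.isProbabilityMeasure_map hX
  have h1 := (memLp_map_measure_iff (g := id) (by fun_prop) hX).2
    (memLp_two_of_charFun_eq_cexp hX hΨ h)
  have h2 := integral_id_of_charFun_eq_cexp hΨ h1 h
  rw [integral_map hX (by fun_prop), ← hm] at h2
  exact_mod_cast h2

lemma integral_sq_eq_of_charFun_eq_cexp {X : Ω → ℝ} (hX : AEMeasurable X P) (hΨ : ContDiff ℝ 2 Ψ)
    (hm : (m : ℂ) = -Complex.I * deriv Ψ 0) (hv : (v : ℂ) = -iteratedDeriv 2 Ψ 0) {t : ℝ}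
    (h : ∀ lam, charFun (P.map X) lam = Complex.exp (t * Ψ lam)) :
    ∫ ω, X ω ^ 2 ∂P = t * v + (t * m) ^ 2 := by
  have := Measure.isProbabilityMeasure_map hX
  have h1 := (memLp_map_measure_iff (g := id) (by fun_prop) hX).2
    (memLp_two_of_charFun_eq_cexp hX hΨ h)
  have h2 := integral_sq_of_charFun_eq_cexp hΨ h1 h
  have hm2 : (deriv Ψ 0) ^ 2 = -(m : ℂ) ^ 2 := by
    rw [hm, mul_pow, neg_sq, Complex.I_sq]
    ring
  rw [integral_map hX (by fun_prop), ← hv, mul_pow, hm2] at h2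
  have h3 : ((∫ ω, X ω ^ 2 ∂P : ℝ) : ℂ) = ((t * v + (t * m) ^ 2 : ℝ) : ℂ) := by
    rw [h2]
    push_cast
    ring
  exact_mod_cast h3

theorem hasLevyIncrements_of_charFun {Y : ℝ → Ω → ℝ} (hΨ : ContDiff ℝ 2 Ψ)
    (hm : (m : ℂ) = -Complex.I * deriv Ψ 0) (hv : (v : ℂ) = -iteratedDeriv 2 Ψ 0)
    (hY : ∀ t, Measurable (Y t))
    (hindep : ∀ t : ℕ → ℝ, Monotone t → 0 ≤ t 0 →
      iIndepFun (fun (i : ℕ) ω => Y (t (i + 1)) ω - Y (t i) ω) P)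
    (hchar : ∀ a b, 0 ≤ a → a ≤ b → ∀ lam,
      charFun (P.map fun ω => Y b ω - Y a ω) lam = Complex.exp (((b - a : ℝ) : ℂ) * Ψ lam)) :
    HasLevyIncrements Y P Ψ m v := by
  have hmeas : ∀ a b, AEMeasurable (fun ω => Y b ω - Y a ω) P := fun a b =>
    ((hY b).sub (hY a)).aemeasurable
  refine ⟨?_, hY, hindep, hchar,
    fun a b ha hab => memLp_two_of_charFun_eq_cexp (hmeas a b) hΨ (hchar a b ha hab),
    fun a b ha hab => integral_eq_of_charFun_eq_cexp (hmeas a b) hΨ hm (hchar a b ha hab),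
    fun a b ha hab => integral_sq_eq_of_charFun_eq_cexp (hmeas a b) hΨ hm hv (hchar a b ha hab)⟩
  -- Nonnegativity of `v` comes from its being the variance of the unit increment.
  have c := hchar 0 1 le_rfl zero_le_one
  have h1 := integral_eq_of_charFun_eq_cexp (hmeas 0 1) hΨ hm c
  have h2 := integral_sq_eq_of_charFun_eq_cexp (hmeas 0 1) hΨ hm hv c
  have h3 := variance_eq_sub (memLp_two_of_charFun_eq_cexp (hmeas 0 1) hΨ c)
  have h4 := variance_nonneg (fun ω => Y 1 ω - Y 0 ω) P
  simp only [Pi.pow_apply] at h3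
  rw [h3, h1, h2] at h4
  linarith

variable {L : ℝ≥0 → Ω → ℝ}

theorem IsLevyProcess.memLp_two_iff (hL : IsLevyProcess L P) (hΨ : IsCumulant L P Ψ) {t : ℝ≥0}
    (ht : 0 < t) : MemLp (L t) 2 P ↔ ContDiff ℝ 2 Ψ := by
  have hm : ∀ t, AEMeasurable (L t) P := fun t => (hL.measurable t).aemeasurable
  refine ⟨fun h => ?_, fun h => memLp_two_of_charFun_eq_cexp (hm t) h (hΨ t)⟩
  have := Measure.isProbabilityMeasure_map (hm t)
  have h1 : MemLp id 2 (P.map (L t)) := (memLp_map_measure_iff (by fun_prop) (hm t)).2 h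
  have h2 : ContDiff ℝ 2 (charFun (P.map (L t))) := contDiff_charFun (n := 2) h1
  rw [funext (hΨ t)] at h2
  exact contDiff_of_contDiff_cexp_mul (n := 2) (hΨ.continuous hm) (by positivity) h2

lemma IsCumulant.exists_real_derivs (hL : IsLevyProcess L P) (hΨ : IsCumulant L P Ψ)
    (h : ContDiff ℝ 2 Ψ) :
    ((∫ ω, L 1 ω ∂P : ℝ) : ℂ) = -Complex.I * deriv Ψ 0 ∧
      (((∫ ω, L 1 ω ^ 2 ∂P) - (∫ ω, L 1 ω ∂P) ^ 2 : ℝ) : ℂ) = -iteratedDeriv 2 Ψ 0 := by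
  have hX := (hL.measurable 1).aemeasurable (μ := P)
  have := Measure.isProbabilityMeasure_map hX
  have h1 := (memLp_map_measure_iff (g := id) (by fun_prop) hX).2
    ((hL.memLp_two_iff hΨ one_pos).2 h)
  have h2 := integral_id_of_charFun_eq_cexp h h1 (hΨ 1)
  have h3 := integral_sq_of_charFun_eq_cexp h h1 (hΨ 1)
  rw [integral_map hX (by fun_prop), NNReal.coe_one, Complex.ofReal_one, one_mul] at h2 h3
  refine ⟨h2, ?_⟩
  push_cast
  rw [h3, h2]
  linear_combination (-(deriv Ψ 0) ^ 2) * Complex.I_sq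

theorem IsLevyProcess.hasLevyIncrements (hL : IsLevyProcess L P) (hΨ : IsCumulant L P Ψ)
    (h : ContDiff ℝ 2 Ψ) (hm : (m : ℂ) = -Complex.I * deriv Ψ 0)
    (hv : (v : ℂ) = -iteratedDeriv 2 Ψ 0) :
    HasLevyIncrements (shiftedProcess L 0) P Ψ m v := by
  refine hasLevyIncrements_of_charFun h hm hv (fun t => hL.measurable _) (fun t ht _ => ?_)
    fun a b ha hab lam => ?_
  · exact hL.indep_increments.nat (t := fun i => (t i - 0).toNNReal) fun i j hij =>
      Real.toNNReal_le_toNNReal (by simpa using ht hij)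
  · have h1 := (hL.stationary_increments a.toNNReal (b - a).toNNReal zero_le).map_eq
    rw [← Real.toNNReal_add ha (sub_nonneg.2 hab), add_sub_cancel] at h1
    simp only [shiftedProcess, sub_zero]
    rw [h1, hΨ, Real.coe_toNNReal _ (sub_nonneg.2 hab)]

/-- Time reversal of a two-sided Lévy process at the origin. -/
theorem IsLevyProcess.hasLevyIncrements_neg {M : ℝ → Ω → ℝ} (hM : IsLevyProcess M P)
    (hML : ∀ (t : ℝ≥0) (ω : Ω), M t ω = L t ω) (hΨ : IsCumulant L P Ψ)
    (h : ContDiff ℝ 2 Ψ) (hm : (m : ℂ) = -Complex.I * deriv Ψ 0)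
    (hv : (v : ℂ) = -iteratedDeriv 2 Ψ 0) :
    HasLevyIncrements (fun u ω => -M (-u) ω) P Ψ m v := by
  refine hasLevyIncrements_of_charFun h hm hv (fun t => (hM.measurable _).neg) (fun t ht _ => ?_)
    fun a b ha hab lam => ?_
  · exact hM.indep_increments.neg_comp_neg.nat ht
  · have h1 := (hM.stationary_increments (-b) (b - a) (sub_nonneg.2 hab)).map_eq
    have h2 : M (b - a) = L (b - a).toNNReal := funext fun ω => by
      rw [← hML, Real.coe_toNNReal _ (sub_nonneg.2 hab)]
    -- The reflected increment over `[a, b]` is the increment of `M` over `[-b, -a]`, of the same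
    -- length.
    have h3 : (fun ω => -M (-b) ω - -M (-a) ω) = fun ω => M (-b + (b - a)) ω - M (-b) ω := by
      funext ω
      rw [show -b + (b - a) = -a by ring]
      ring
    rw [h3, h1, h2, hΨ, Real.coe_toNNReal _ (sub_nonneg.2 hab)]

end Construction

/-! ### Change of variables and uniqueness for Riemann–Stieltjes integrals -/

section StochIntegral

variable {Ω : Type*} [MeasurableSpace Ω] {P : Measure Ω} {Y : ℝ → Ω → ℝ} {g h : ℝ → ℝ}
  {X X' : Ω → ℝ}

lemma IsStochIntegral.shift {s : ℝ} (hX : IsStochIntegral P Y g 0 (-s) X) :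
    IsStochIntegral P (fun t => Y (t - s)) (fun r => g (r - s)) s 0 X := by
  refine ⟨hX.1, fun ε hε => ?_⟩
  obtain ⟨δ, hδ, H⟩ := hX.2 ε hε
  refine ⟨δ, hδ, fun N t ξ ht h0 hN hmesh hξ => ?_⟩
  refine H N (fun k => t k - s) (fun k => ξ k - s) (fun i j hij => sub_le_sub_right (ht hij) _)
    (by simp [h0]) (by simp [hN]) (fun k hk => ?_) fun k hk => ?_
  · simpa using hmesh k hk
  · exact ⟨sub_le_sub_right (hξ k hk).1 _, sub_le_sub_right (hξ k hk).2 _⟩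

/-- Reflecting a tagged partition of `[s, 0]` and reversing its order gives one of `[0, -s]` with
the same Riemann sum. The shift `c` cancels in increments and allows for `M t - M s`. -/
lemma IsStochIntegral.reflect {M : ℝ → Ω → ℝ} {s : ℝ}
    (hX : IsStochIntegral P (fun u ω => -M (-u) ω) g 0 (-s) X) (c : Ω → ℝ) :
    IsStochIntegral P (fun t ω => M t ω - c ω) (fun r => g (-r)) s 0 X := by
  refine ⟨hX.1, fun ε hε => ?_⟩
  obtain ⟨δ, hδ, H⟩ := hX.2 ε hε
  refine ⟨δ, hδ, fun N t ξ ht h0 hN hmesh hξ => ?_⟩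
  have hk1 : ∀ k < N, N - (k + 1) < N ∧ N - k = N - (k + 1) + 1 := fun k hk => by omega
  have hsum : ∀ ω, ∑ k ∈ Finset.range N, g (-ξ k) * (M (t (k + 1)) ω - c ω - (M (t k) ω - c ω))
      = ∑ k ∈ Finset.range N, g (-ξ (N - (k + 1)))
        * (-M (- -t (N - (k + 1))) ω - -M (- -t (N - k)) ω) := by
    intro ω
    rw [← Finset.sum_range_reflect]
    refine Finset.sum_congr rfl fun k hk => ?_
    have hk' := Finset.mem_range.1 hk
    have e1 : N - 1 - k = N - (k + 1) := by omega
    rw [e1, ← (hk1 k hk').2, neg_neg, neg_neg]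
    ring
  have := H N (fun k => -t (N - k)) (fun k => -ξ (N - (k + 1)))
    (fun i j hij => neg_le_neg (ht (Nat.sub_le_sub_left hij N))) (by simp [hN]) (by simp [h0])
    (fun k hk => ?_) fun k hk => ?_
  · simp only [hsum]
    exact this
  · obtain ⟨e1, e2⟩ := hk1 k hk
    have := hmesh _ e1
    rw [← e2] at this
    linarith
  · obtain ⟨e1, e2⟩ := hk1 k hk
    have := hξ _ e1
    rw [← e2] at this
    exact ⟨neg_le_neg this.2, neg_le_neg this.1⟩

lemma IsStochIntegral.tendstoInMeasure {a b : ℝ} (hab : a ≤ b)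
    (hX : IsStochIntegral P Y h a b X) :
    TendstoInMeasure P (fun N ω => ∑ k ∈ Finset.range (N + 1),
      h (a + k * ((b - a) / (N + 1 : ℕ))) * (Y (a + (k + 1 : ℕ) * ((b - a) / (N + 1 : ℕ))) ω
        - Y (a + k * ((b - a) / (N + 1 : ℕ))) ω)) atTop X := by
  rw [tendstoInMeasure_iff_norm]
  intro ε hε
  rw [ENNReal.tendsto_atTop_zero]
  intro η hη
  obtain ⟨η', hη'0, hη'⟩ : ∃ η' : ℝ, 0 < η' ∧ ENNReal.ofReal η' ≤ η := by
    rcases eq_or_ne η ⊤ with h | h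
    · exact ⟨1, one_pos, h ▸ le_top⟩
    · exact ⟨η.toReal, ENNReal.toReal_pos hη.ne' h, ENNReal.ofReal_toReal_le⟩
  -- A single parameter bounds both the deviation and its probability in `IsStochIntegral`, whence
  -- the minimum.
  obtain ⟨δ, hδ, H⟩ := hX.2 (min ε η') (lt_min hε hη'0)
  have hmesh : Tendsto (fun N : ℕ => (b - a) / ((N + 1 : ℕ) : ℝ)) atTop (𝓝 0) :=
    (tendsto_const_div_atTop_nhds_zero_nat (b - a)).comp (tendsto_add_atTop_nat 1)
  obtain ⟨N₀, hN₀⟩ := eventually_atTop.1 (hmesh.eventually_lt_const hδ)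
  refine ⟨N₀, fun N hN => ?_⟩
  have hstep : 0 ≤ (b - a) / ((N + 1 : ℕ) : ℝ) := div_nonneg (sub_nonneg.2 hab) (by positivity)
  have hmono : Monotone fun k : ℕ => a + k * ((b - a) / ((N + 1 : ℕ) : ℝ)) := fun i j hij => by
    simp only
    gcongr
  have := H (N + 1) (fun k => a + k * ((b - a) / (N + 1 : ℕ)))
    (fun k => a + k * ((b - a) / (N + 1 : ℕ))) hmono (by simp) ?_ (fun k _ => ?_)
    fun k _ => ⟨le_rfl, hmono k.le_succ⟩
  · refine (measure_mono fun ω hω => ?_).trans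
      (this.trans ((ENNReal.ofReal_le_ofReal (min_le_right _ _)).trans hη'))
    exact (min_le_left _ _).trans (show ε ≤ |_| from hω)
  · field_simp
    ring
  · have := hN₀ N hN
    push_cast at this ⊢
    linarith

/-- The stochastic integral is almost surely unique. -/
theorem IsStochIntegral.ae_eq {a b : ℝ} (hab : a ≤ b) (hX : IsStochIntegral P Y h a b X)
    (hX' : IsStochIntegral P Y h a b X') : X =ᵐ[P] X' :=
  tendstoInMeasure_ae_unique (hX.tendstoInMeasure hab) (hX'.tendstoInMeasure hab)

theorem IsImproperStochIntegral.ae_eq {L : ℝ≥0 → Ω → ℝ}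
    (hX : IsImproperStochIntegral P L h X) (hX' : IsImproperStochIntegral P L h X') :
    X =ᵐ[P] X' := by
  obtain ⟨_, J, hJ, hJX⟩ := hX
  obtain ⟨_, J', hJ', hJX'⟩ := hX'
  refine tendstoInMeasure_ae_unique hJX (hJX'.congr' ?_ ae_eq_rfl)
  filter_upwards [eventually_ge_atTop 0] with T hT using (hJ' T hT).ae_eq hT (hJ T hT)

/-- A large distance in the sup metric forces a large distance in some coordinate, so a union bound
suffices. -/
lemma tendstoInMeasure_pi {ι κ : Type*} [Fintype ι] {l : Filter κ} {f : κ → ι → Ω → ℝ}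
    {g : ι → Ω → ℝ} (hf : ∀ i, TendstoInMeasure P (fun k => f k i) l (g i)) :
    TendstoInMeasure P (fun k ω i => f k i ω) l (fun ω i => g i ω) := by
  intro ε hε
  have hsum : Tendsto (fun k => ∑ i, P {ω | ε ≤ edist (f k i ω) (g i ω)}) l (𝓝 0) := by
    have := tendsto_finsetSum Finset.univ fun i _ => hf i ε hε
    simpa using this
  refine tendsto_of_tendsto_of_tendsto_of_le_of_le tendsto_const_nhds hsum
    (fun _ => zero_le) fun k => ?_
  refine (measure_mono fun ω hω => ?_).trans (measure_iUnion_fintype_le P _)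
  rw [mem_iUnion]
  by_contra! hcon
  have h1 : ∀ i, edist (f k i ω) (g i ω) < ε := fun i => lt_of_not_ge (hcon i)
  have h2 : edist (fun i => f k i ω) (fun i => g i ω) < ε := by
    rw [edist_pi_def, Finset.sup_lt_iff hε]
    exact fun i _ => h1 i
  exact absurd (show ε ≤ edist (fun i => f k i ω) (fun i => g i ω) from hω) (not_le.2 h2)

end StochIntegral

/-! ### Pull-back limits and moments -/

section KernelIntegrals

variable {Ω : Type*} [MeasurableSpace Ω] {P : Measure Ω}
  [IsProbabilityMeasure P] {Ψ : ℝ → ℂ} {m v ν : ℝ} {L : ℝ≥0 → Ω → ℝ}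

lemma isLevyIntegrand_kernelH (hν : 0 ≤ ν) (n : ℕ) : IsLevyIntegrand (kernelH ν n) := by
  refine ⟨integrableOn_kernelH hν n,
    (memLp_two_iff_integrable_sq (continuous_kernelH ν n).aestronglyMeasurable).2 ?_⟩
  have := integrableOn_kernelH_mul_kernelH hν n n
  simp only [← pow_two] at this
  exact this

lemma isImproperStochIntegral_levyIntegral
    (hY : HasLevyIncrements (shiftedProcess L 0) P Ψ m v) {h : ℝ → ℝ} (hh : IsLevyIntegrand h)
    (hc : Continuous h) : IsImproperStochIntegral P L h (hY.levyIntegral h) :=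
  ⟨hY.aemeasurable_levyIntegral h, fun T => hY.levyIntegral ((Ioc 0 T).indicator h),
    fun _ hT => hY.isStochIntegral_levyIntegral hc hT,
    tendstoInMeasure_of_tendsto_Lp (hY.tendsto_levyIntegral_indicator hh hc)⟩

/-- Moving the time origin to `s` exchanges the shifted process for `L` itself and makes the
integrand `h (-s - r)`, which varies with `s`; a limit is therefore only sought in law. -/
lemma isStochIntegral_shiftedProcess (hY : HasLevyIncrements (shiftedProcess L 0) P Ψ m v)
    {h : ℝ → ℝ} (hc : Continuous h) {s : ℝ} (hs : s ≤ 0) :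
    IsStochIntegral P (shiftedProcess L s) (fun r => h (-r)) s 0
      (hY.levyIntegral ((Ioc 0 (-s)).indicator fun r => h (-s - r))) := by
  have h1 := (hY.isStochIntegral_levyIntegral (h := fun r => h (-s - r)) (by fun_prop)
    (neg_nonneg.2 hs)).shift
  have e1 : (fun t => shiftedProcess L 0 (t - s)) = shiftedProcess L s := by
    funext t
    simp [shiftedProcess]
  have e2 : (fun r => h (-s - (r - s))) = fun r => h (-r) := by
    funext r
    congr 1
    ring
  rwa [e1, e2] at h1

/-- For each `s ≤ 0` the joint law is that of the integrals of `g i` over `(0, -s]`, by time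
reversal, and those converge in `L²`. -/
theorem tendstoInDistribution_levyIntegral_reverse {Y : ℝ → Ω → ℝ}
    (hY : HasLevyIncrements Y P Ψ m v) {ι : Type*} [Fintype ι] {g : ι → ℝ → ℝ} (hg : ∀ i, IsLevyIntegrand (g i))
    (hc : ∀ i, Continuous (g i)) :
    TendstoInDistribution
      (fun s ω i => hY.levyIntegral ((Ioc 0 (-s)).indicator fun r => g i (-s - r)) ω) atBot
      (fun ω i => hY.levyIntegral (g i) ω) (fun _ => P) P := by
  have h1 : TendstoInDistribution
      (fun T ω i => hY.levyIntegral ((Ioc 0 T).indicator (g i)) ω) atTop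
      (fun ω i => hY.levyIntegral (g i) ω) (fun _ => P) P :=
    (tendstoInMeasure_pi fun i => tendstoInMeasure_of_tendsto_Lp
      (hY.tendsto_levyIntegral_indicator (hg i) (hc i))).tendstoInDistribution fun T =>
        aemeasurable_pi_lambda _ fun i => hY.aemeasurable_levyIntegral _
  refine ⟨fun s => aemeasurable_pi_lambda _ fun i => hY.aemeasurable_levyIntegral _,
    h1.aemeasurable_limit, (h1.tendsto.comp tendsto_neg_atBot_atTop).congr' ?_⟩
  filter_upwards [eventually_le_atBot 0] with s hs
  exact Subtype.ext (hY.map_levyIntegral_indicator_reverse hc (neg_nonneg.2 hs)).symm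

theorem exists_pullback_of_two_sided (hΨ : IsCumulant L P Ψ)
    (hΨ2 : ContDiff ℝ 2 Ψ) (hm : (m : ℂ) = -Complex.I * deriv Ψ 0)
    (hv : (v : ℂ) = -iteratedDeriv 2 Ψ 0)
    (hY : HasLevyIncrements (shiftedProcess L 0) P Ψ m v) {M : ℝ → Ω → ℝ}
    (hM : IsLevyProcess M P) (hML : ∀ (t : ℝ≥0) (ω : Ω), M t ω = L t ω) {g : ℕ → ℝ → ℝ}
    (hg : ∀ n, IsLevyIntegrand (g n)) (hc : ∀ n, Continuous (g n)) :
    ∃ (X : ℝ → ℕ → Ω → ℝ) (b : ℕ → Ω → ℝ),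
      (∀ s ≤ 0, ∀ n, IsStochIntegral P (fun t ω => M t ω - M s ω) (fun r => g n (-r)) s 0
        (X s n)) ∧
      (∀ n, TendstoInMeasure P (fun s => X s n) atBot (b n)) ∧
      IdentDistrib (fun ω n => b n ω) (fun ω n => hY.levyIntegral (g n) ω) P P := by
  have hN := hM.hasLevyIncrements_neg hML hΨ hΨ2 hm hv
  refine ⟨fun s n => hN.levyIntegral ((Ioc 0 (-s)).indicator (g n)),
    fun n => hN.levyIntegral (g n), fun s hs n => ?_, fun n => ?_, ?_⟩
  · exact (hN.isStochIntegral_levyIntegral (hc n) (neg_nonneg.2 hs)).reflect _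
  · exact tendstoInMeasure_of_tendsto_Lp
      ((hN.tendsto_levyIntegral_indicator (hg n) (hc n)).comp tendsto_neg_atBot_atTop)
  · have h1 : AEMeasurable (fun ω n => hN.levyIntegral (g n) ω) P :=
      aemeasurable_pi_lambda _ fun n => hN.aemeasurable_levyIntegral _
    have h2 : AEMeasurable (fun ω n => hY.levyIntegral (g n) ω) P :=
      aemeasurable_pi_lambda _ fun n => hY.aemeasurable_levyIntegral _
    -- The law of the sequence is determined by its finite-dimensional marginals, and these depend
    -- only on the common cumulant.
    refine (identDistrib_iff_forall_finset_identDistrib (X := fun n => hN.levyIntegral (g n))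
      (Y := fun n => hY.levyIntegral (g n)) h1 h2).2 fun I => ⟨?_, ?_, ?_⟩
    · exact (Finset.measurable_restrict I).comp_aemeasurable h1
    · exact (Finset.measurable_restrict I).comp_aemeasurable h2
    · exact hN.map_levyIntegral_eq hY (fun i : I => hg i) fun i : I => hc i

/-- First and second moments of improper stochastic integrals with respect to a square integrable
Lévy process. -/
theorem IsLevyProcess.moments_of_isImproperStochIntegral (hL : IsLevyProcess L P)
    (hL2 : MemLp (L 1) 2 P) {g h : ℝ → ℝ} (hg : IsLevyIntegrand g) (hgc : Continuous g)
    (hh : IsLevyIntegrand h) (hhc : Continuous h) {a b : Ω → ℝ}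
    (ha : IsImproperStochIntegral P L g a) (hb : IsImproperStochIntegral P L h b) :
    MemLp a 2 P ∧ (∫ ω, a ω ∂P = (∫ ω, L 1 ω ∂P) * ∫ r in Ioi 0, g r) ∧
      ∫ ω, a ω * b ω ∂P
        = ((∫ ω, L 1 ω ^ 2 ∂P) - (∫ ω, L 1 ω ∂P) ^ 2) * (∫ r in Ioi 0, g r * h r)
          + (∫ ω, L 1 ω ∂P) ^ 2 * (∫ r in Ioi 0, g r) * ∫ r in Ioi 0, h r := by
  obtain ⟨Ψ, hΨ, -⟩ := hL.existsUnique_isCumulant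
  have hΨ2 := (hL.memLp_two_iff hΨ one_pos).1 hL2
  obtain ⟨hm, hv⟩ := hΨ.exists_real_derivs hL hΨ2
  have hY := hL.hasLevyIncrements hΨ hΨ2 hm hv
  have ea := ha.ae_eq (isImproperStochIntegral_levyIntegral hY hg hgc)
  have eb := hb.ae_eq (isImproperStochIntegral_levyIntegral hY hh hhc)
  refine ⟨(memLp_congr_ae ea).2 (Lp.memLp _), ?_, ?_⟩
  · rw [integral_congr_ae ea, hY.integral_levyIntegral hg.memLp]
  · refine (integral_congr_ae (ea.mul eb)).trans ?_
    exact hY.integral_levyIntegral_mul hg.memLp hh.memLp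

end KernelIntegrals

theorem mainTheorem2 {Ω Ω' : Type*} [MeasurableSpace Ω] [MeasurableSpace Ω']
    (P : Measure Ω) [IsProbabilityMeasure P] (P' : Measure Ω') [IsProbabilityMeasure P']
    (L : ℝ≥0 → Ω → ℝ) (L' : ℝ≥0 → Ω' → ℝ)
    (hL : IsLevyProcess L P) (hL' : IsLevyProcess L' P') (ν : ℝ) (hν : 0 ≤ ν) :
    -- the cumulant exists and is unique
    (∃! Ψ : ℝ → ℂ, IsCumulant L P Ψ) ∧
    (∀ Ψ : ℝ → ℂ, IsCumulant L P Ψ →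
      -- finiteness of second moments is equivalent to twice continuous differentiability of `Ψ`
      (∀ t : ℝ≥0, 0 < t → (MemLp (L t) 2 P ↔ ContDiff ℝ 2 Ψ)) ∧
      (ContDiff ℝ 2 Ψ →
        (∀ n : ℕ, IntegrableOn (kernelH ν n) (Ioi 0)) ∧
        (∀ m n : ℕ, IntegrableOn (fun r => kernelH ν m r * kernelH ν n r) (Ioi 0)) ∧
        ∃ a : ℕ → Ω → ℝ,
          -- `a n = ∫_0^∞ H_n dL`
          (∀ n, IsImproperStochIntegral P L (kernelH ν n) (a n)) ∧
          -- pull-back limit in law of `∫_s^0 H_n(-r) dL_s(r)`, jointly in `n`, as `s → -∞`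
          (∃ X : ℝ → ℕ → Ω → ℝ,
            (∀ s ≤ 0, ∀ n,
              IsStochIntegral P (shiftedProcess L s) (fun r => kernelH ν n (-r)) s 0 (X s n)) ∧
            ∀ I : Finset ℕ,
              TendstoInDistribution (fun s ω (n : I) => X s n ω) atBot
                (fun ω (n : I) => a n ω) (fun _ => P) P) ∧
          -- pull-back limit in probability, if `L` is the restriction of a two-sided process
          (∀ M : ℝ → Ω → ℝ, IsLevyProcess M P → (∀ (t : ℝ≥0) (ω : Ω), M t ω = L t ω) →
            ∃ (X : ℝ → ℕ → Ω → ℝ) (b : ℕ → Ω → ℝ),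
              (∀ s ≤ 0, ∀ n,
                IsStochIntegral P (fun t ω => M t ω - M s ω) (fun r => kernelH ν n (-r)) s 0
                  (X s n)) ∧
              (∀ n, TendstoInMeasure P (fun s => X s n) atBot (b n)) ∧
              IdentDistrib (fun ω n => b n ω) (fun ω n => a n ω) P P) ∧
          -- means, second moments and covariances
          (∀ n, MemLp (a n) 2 P) ∧
          (∀ n, ((∫ ω, a n ω ∂P : ℝ) : ℂ)
            = -Complex.I * deriv Ψ 0 * ((∫ r in Ioi 0, kernelH ν n r : ℝ) : ℂ)) ∧
          (∀ m n, ((∫ ω, a m ω * a n ω ∂P : ℝ) : ℂ)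
            = -iteratedDeriv 2 Ψ 0 * ((∫ r in Ioi 0, kernelH ν m r * kernelH ν n r : ℝ) : ℂ)
              - (deriv Ψ 0) ^ 2 * ((∫ r in Ioi 0, kernelH ν m r : ℝ) : ℂ)
                * ((∫ r in Ioi 0, kernelH ν n r : ℝ) : ℂ)) ∧
          (∀ m n, ((covariance (a m) (a n) P : ℝ) : ℂ)
            = -iteratedDeriv 2 Ψ 0
              * ((∫ r in Ioi 0, kernelH ν m r * kernelH ν n r : ℝ) : ℂ)))) ∧
    -- equal first and second moments of the forcing give the same covariance structure
    (MemLp (L 1) 2 P → MemLp (L' 1) 2 P' →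
      (∫ ω, L 1 ω ∂P) = (∫ ω, L' 1 ω ∂P') →
      (∫ ω, (L 1 ω) ^ 2 ∂P) = (∫ ω, (L' 1 ω) ^ 2 ∂P') →
      ∀ (a : ℕ → Ω → ℝ) (a' : ℕ → Ω' → ℝ),
        (∀ n, IsImproperStochIntegral P L (kernelH ν n) (a n)) →
        (∀ n, IsImproperStochIntegral P' L' (kernelH ν n) (a' n)) →
        (∀ n, (∫ ω, a n ω ∂P) = ∫ ω, a' n ω ∂P') ∧
        (∀ m n, (∫ ω, a m ω * a n ω ∂P) = ∫ ω, a' m ω * a' n ω ∂P') ∧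
        (∀ m n, covariance (a m) (a n) P = covariance (a' m) (a' n) P')) := by
  have hk : ∀ n, IsLevyIntegrand (kernelH ν n) := isLevyIntegrand_kernelH hν
  have hc : ∀ n, Continuous (kernelH ν n) := continuous_kernelH ν
  refine ⟨hL.existsUnique_isCumulant, fun Ψ hΨ => ⟨fun t ht => hL.memLp_two_iff hΨ ht,
    fun hΨ2 => ⟨integrableOn_kernelH hν, integrableOn_kernelH_mul_kernelH hν, ?_⟩⟩, ?_⟩
  · obtain ⟨hm, hv⟩ := hΨ.exists_real_derivs hL hΨ2
    have hY := hL.hasLevyIncrements hΨ hΨ2 hm hv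
    have ha : ∀ n, IsImproperStochIntegral P L (kernelH ν n) (hY.levyIntegral (kernelH ν n)) :=
      fun n => isImproperStochIntegral_levyIntegral hY (hk n) (hc n)
    have hmom := fun m n => hL.moments_of_isImproperStochIntegral
      ((hL.memLp_two_iff hΨ one_pos).2 hΨ2) (hk m) (hc m) (hk n) (hc n) (ha m) (ha n)
    -- Since `E L(1) = -iΨ'(0)`, the squared mean appears as `-Ψ'(0)²` in the mixed moments.
    have hsq : (deriv Ψ 0) ^ 2 = -((∫ ω, L 1 ω ∂P : ℝ) : ℂ) ^ 2 := by
      rw [hm, mul_pow, neg_sq, Complex.I_sq]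
      ring
    refine ⟨fun n => hY.levyIntegral (kernelH ν n), ha,
      ⟨fun s n => hY.levyIntegral ((Ioc 0 (-s)).indicator fun r => kernelH ν n (-s - r)),
        fun s hs n => isStochIntegral_shiftedProcess hY (hc n) hs,
        fun I => tendstoInDistribution_levyIntegral_reverse hY (fun i : I => hk i)
          fun i : I => hc i⟩,
      fun M hM hML => exists_pullback_of_two_sided hΨ hΨ2 hm hv hY hM hML hk hc,
      fun n => Lp.memLp _, fun n => ?_, fun m n => ?_, fun m n => ?_⟩
    · rw [(hmom n n).2.1, ← hm]
      push_cast
      ring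
    · rw [(hmom m n).2.2, ← hv, hsq]
      push_cast
      ring
    · have := covariance_eq_sub (hmom m m).1 (hmom n n).1
      simp only [Pi.mul_apply] at this
      rw [this, (hmom m n).2.2, (hmom m m).2.1, (hmom n n).2.1, ← hv]
      push_cast
      ring
  · intro h2 h2' e1 e2 a a' ha ha'
    have hmom := fun m n => hL.moments_of_isImproperStochIntegral h2 (hk m) (hc m) (hk n) (hc n)
      (ha m) (ha n)
    have hmom' := fun m n => hL'.moments_of_isImproperStochIntegral h2' (hk m) (hc m) (hk n) (hc n)
      (ha' m) (ha' n)
    have hmean : ∀ n, (∫ ω, a n ω ∂P) = ∫ ω, a' n ω ∂P' := fun n => by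
      rw [(hmom n n).2.1, (hmom' n n).2.1, e1]
    have hmul : ∀ m n, (∫ ω, a m ω * a n ω ∂P) = ∫ ω, a' m ω * a' n ω ∂P' := fun m n => by
      rw [(hmom m n).2.2, (hmom' m n).2.2, e1, e2]
    refine ⟨hmean, hmul, fun m n => ?_⟩
    have c1 := covariance_eq_sub (hmom m m).1 (hmom n n).1
    have c2 := covariance_eq_sub (hmom' m m).1 (hmom' n n).1
    simp only [Pi.mul_apply] at c1 c2
    rw [c1, c2, hmean, hmean, hmul]
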